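/- Let $n\ge 1$ and let $\hbar\neq 0$ be real. Work in an affine chart $\mathbb{R}^n$ of the sphere $S^n$ with coordinates $x^1,\dots,x^n$ and dual fibre coordinates $\xi_1,\dots,\xi_n$ (summation convention). The infinitesimal action of $\mathrm{SL}(n+1,\mathbb{R})$ is spanned by the vector fields $\partial/\partial x^i$, $x^i\,\partial/\partial x^j$, $x^ix^j\,\partial/\partial x^j$. Let $\mathcal{F}_{1/2}$ be the space of complex smooth half-densities, i.e. $C^\infty(\mathbb{R}^n,\mathbb{C})$ on which a vector field $X$ acts by $L_X=X^i\partial_i+\tfrac12(\partial_iX^i)$; let $\mathcal{D}$ be the space of linear differential operators on $\mathcal{F}_{1/2}$ with smooth coefficients, on which $X$ acts by $A\mapsto L_XA-AL_X$; and let $\mathcal{S}=\bigoplus_k\mathcal{S}_k$ be the space of symbols $P(x,\xi)$, polynomial in $\xi$ with smooth complex coefficients, graded by the degree in $\xi$, on which $X$ acts by $X^i\partial_{x^i}-(\partial_jX^i)\,\xi_i\,\partial_{\xi_j}$. A projectively equivariant quantization map is a linear map $\mathcal{Q}:\mathcal{S}\to\mathcal{D}$ that commutes with the action of the above vector fields and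 sends each $P=\sum_{|\alpha|=k}P_\alpha\xi^\alpha\in\mathcal{S}_k$ to $(-i\hbar)^k\sum_{|\alpha|=k}P_\alpha\partial^\alpha$ plus an operator of order less than $k$. Put $$\mathcal{E}=\xi_i\frac{\partial}{\partial\xi_i},\qquad \mathrm{D}=\frac{\partial}{\partial x^i}\frac{\partial}{\partial\xi_i},\qquad \mathrm{E}=\mathcal{E}+\frac n2,\qquad Z=\frac{i\hbar\mathrm{D}}{4},$$ and, for operators $a_1,\dots,a_p,b_1,\dots,b_p$ on $\mathcal{S}$ that are polynomials in $\mathcal{E}$, $$F\left(\left.\begin{array}{c}a_1,\dots,a_p\\ b_1,\dots,b_p\end{array}\right|Z\right)=\sum_{m\ge0}\frac1{m!}\,\frac{(a_1)_m\cdots(a_p)_m}{(b_1)_m\cdots(b_p)_m}\,Z^m,\qquad (a)_m=a(a+1)\cdots(a+m-1),$$ with $Z$ written to the right. Identify symbols with operators in the chart by $$\mathcal{I}(P)\phi=\sum_\alpha(-i\hbar)^{|\alpha|}\,\partial^\alpha(P_\alpha\phi)\qquad\text{for } P=\sum_\alpha P_\alpha(x)\,\xi^\alpha,$$ which is the operator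 with oscillatory kernel $e^{(i/\hbar)\langle\xi,x-y\rangle}P(y,\xi)$. Then the operators $(\mathrm{E})_m$, $(\mathcal{E}+\tfrac n2)_m$ and $(\mathcal{E}+\tfrac{n+1}2)_m$ are invertible on $\mathcal{S}$ for all $m$, and for each $P\in\mathcal{S}$ one has $Z^mP=0$ for all large $m$. There is exactly one projectively equivariant quantization map $\mathcal{Q}_{\frac12,\frac12}:\mathcal{S}\to\mathcal{D}$. It is given on each $\mathcal{S}_k$ by $$\mathcal{Q}_{\frac12,\frac12}\big|_{\mathcal{S}_k}=\mathcal{I}\circ\sum_{m=0}^kC_m^k\,(i\hbar\mathrm{D})^m,\qquad C_0^k=1,\quad C_{m+1}^k=\frac{k-m-1+\frac{n+1}2}{(m+1)(2k-m-2+n+1)}\,C_m^k,$$ and on all of $\mathcal{S}$ by the hypergeometric series with four parameters, which reduces to the confluent hypergeometric series: $$\mathcal{Q}_{\frac12,\frac12}=\mathcal{I}\circ F\left(\left.\begin{array}{c}\mathcal{E}+\frac{n+1}2,\;2\mathcal{E}+n\\[2pt] \mathcal{E}+\frac n2,\;\mathcal{E}+\frac{n+1}2\end{array}\right|Z\right)=\mathcal{I}\circ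 F\left(\left.\begin{array}{c}2\mathrm{E}\\ \mathrm{E}\end{array}\right|\frac{i\hbar\mathrm{D}}4\right).$$ The two hypergeometric series agree already as operators on $\mathcal{S}$. -/

import Mathlib

open scoped ContDiff

noncomputable section

namespace ProjQuant

/-! ### Functions, densities and symbols in an affine chart -/

/-- The smooth complex-valued functions, as a subalgebra of all functions on `ℝⁿ`. -/
def smoothSubalgebra (n : ℕ) : Subalgebra ℂ ((Fin n → ℝ) → ℂ) where
  carrier := {f | ContDiff ℝ ∞ f}
  mul_mem' {f g} (hf : ContDiff ℝ ∞ f) (hg : ContDiff ℝ ∞ g) := ContDiff.mul hf hg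
  add_mem' {f g} (hf : ContDiff ℝ ∞ f) (hg : ContDiff ℝ ∞ g) := ContDiff.add hf hg
  algebraMap_mem' c := (contDiff_const : ContDiff ℝ ∞ fun _ : Fin n → ℝ => c)

/-- The algebra `C^∞(ℝⁿ, ℂ)` of smooth complex-valued functions on the affine chart `ℝⁿ` of the
sphere `Sⁿ`. In the affine coordinates `x¹, …, xⁿ` a density of degree `lam` is such a function. -/
def SmoothFn (n : ℕ) : Type := smoothSubalgebra n

instance (n : ℕ) : CommRing (SmoothFn n) := inferInstanceAs (CommRing (smoothSubalgebra n))

instance (n : ℕ) : Algebra ℂ (SmoothFn n) := inferInstanceAs (Algebra ℂ (smoothSubalgebra n))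

namespace SmoothFn

/-- The underlying function. -/
def toFun {n : ℕ} (f : SmoothFn n) : (Fin n → ℝ) → ℂ := f.1

theorem smooth {n : ℕ} (f : SmoothFn n) : ContDiff ℝ ∞ f.toFun := f.2

theorem differentiableAt {n : ℕ} (f : SmoothFn n) (x : Fin n → ℝ) :
    DifferentiableAt ℝ f.toFun x := (f.smooth.differentiable (by simp)) x

theorem ext {n : ℕ} {f g : SmoothFn n} (h : ∀ x, f.toFun x = g.toFun x) : f = g :=
  Subtype.ext (funext h)

end SmoothFn

/-- The partial derivative `∂/∂xⁱ` on `C^∞(ℝⁿ, ℂ)`. -/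
def pd {n : ℕ} (i : Fin n) : Derivation ℂ (SmoothFn n) (SmoothFn n) :=
  Derivation.mk'
    { toFun := fun f => ⟨fun x => fderiv ℝ f.toFun x (Pi.single i 1),
        (f.smooth.fderiv_right (m := ∞) (by simp)).clm_apply contDiff_const⟩
      map_add' := fun f g => SmoothFn.ext fun x =>
        congrArg (fun L => L (Pi.single i 1))
          (fderiv_add (f.differentiableAt x) (g.differentiableAt x))
      map_smul' := fun c f => SmoothFn.ext fun x =>
        congrArg (fun L => L (Pi.single i 1)) (fderiv_const_smul (f.differentiableAt x) c) }
    (fun f g => SmoothFn.ext fun x =>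
      congrArg (fun L => L (Pi.single i 1))
        (fderiv_mul (f.differentiableAt x) (g.differentiableAt x)))

/-- The coordinate function `xⁱ`. -/
def coord {n : ℕ} (i : Fin n) : SmoothFn n :=
  ⟨fun x => ((x i : ℝ) : ℂ),
    (Complex.ofRealCLM.contDiff.comp (contDiff_apply ℝ ℝ i) :
      ContDiff ℝ ∞ fun x : Fin n → ℝ => ((x i : ℝ) : ℂ))⟩

/-- Symbols: polynomials in the fibre coordinates `ξ₁, …, ξₙ` (the variables `MvPolynomial.X i`)
whose coefficients are smooth functions of `x`, that is, the smooth functions on `T*ℝⁿ` that are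
polynomial on the fibres. -/
abbrev Symb (n : ℕ) := MvPolynomial (Fin n) (SmoothFn n)

theorem coeff_sum_monomial_pd {n : ℕ} (i : Fin n) (p : Symb n) (β : Fin n →₀ ℕ) :
    (∑ α ∈ p.support, MvPolynomial.monomial α (pd i (p.coeff α))).coeff β = pd i (p.coeff β) := by
  classical
  rw [MvPolynomial.coeff_sum]
  simp only [MvPolynomial.coeff_monomial, Finset.sum_ite_eq', MvPolynomial.mem_support_iff]
  split_ifs with h
  · rfl
  · rw [not_not.mp h, map_zero]

/-- The operator `∂/∂xⁱ` on symbols (it acts on the coefficients). -/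
def pdx {n : ℕ} (i : Fin n) : Module.End ℂ (Symb n) where
  toFun p := ∑ α ∈ p.support, MvPolynomial.monomial α (pd i (p.coeff α))
  map_add' p q := by
    ext1 β
    rw [MvPolynomial.coeff_add]
    repeat rw [coeff_sum_monomial_pd]
    rw [MvPolynomial.coeff_add, map_add]
  map_smul' c p := by
    ext1 β
    rw [RingHom.id_apply, MvPolynomial.coeff_smul]
    repeat rw [coeff_sum_monomial_pd]
    rw [MvPolynomial.coeff_smul, Derivation.map_smul]

/-- The operator `∂/∂ξᵢ` on symbols. -/
def pdxi {n : ℕ} (i : Fin n) : Module.End ℂ (Symb n) :=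
  (MvPolynomial.pderiv i : Derivation (SmoothFn n) (Symb n) (Symb n)).toLinearMap.restrictScalars ℂ

/-- Multiplication of symbols by the symbol `a`. -/
def mulBy {n : ℕ} (a : Symb n) : Module.End ℂ (Symb n) := LinearMap.mulLeft ℂ a

/-- The Euler operator `ξᵢ ∂/∂ξᵢ`. -/
def euler (n : ℕ) : Module.End ℂ (Symb n) := ∑ i, mulBy (MvPolynomial.X i) * pdxi i

/-- The divergence operator `∂/∂xⁱ ∂/∂ξᵢ`. -/
def divg (n : ℕ) : Module.End ℂ (Symb n) := ∑ i, pdx i * pdxi i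

/-! ### Differential operators -/

/-- Linear operators on `C^∞(ℝⁿ, ℂ)`. -/
abbrev Op (n : ℕ) := Module.End ℂ (SmoothFn n)

/-- The iterated partial derivative `∂^α`. -/
def pdPow {n : ℕ} (α : Fin n →₀ ℕ) : Op n :=
  (List.ofFn fun i => ((pd i).toLinearMap : Op n) ^ α i).prod

/-- The differential operator `φ ↦ ∑_α a_α ∂^α φ` with coefficients those of `q = ∑_α a_α ξ^α`. -/
def coeffOp {n : ℕ} (q : Symb n) : Op n :=
  ∑ α ∈ q.support, LinearMap.mulLeft ℂ (q.coeff α) * pdPow α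

theorem coeffOp_eq_sum {n : ℕ} (q : Symb n) (s : Finset (Fin n →₀ ℕ)) (h : q.support ⊆ s) :
    coeffOp q = ∑ α ∈ s, LinearMap.mulLeft ℂ (q.coeff α) * pdPow α := by
  refine Finset.sum_subset h fun α _ hα => ?_
  rw [MvPolynomial.notMem_support_iff.mp hα]
  ext1 φ
  simp

/-- The space of linear differential operators with smooth coefficients on `ℝⁿ`, from densities of
degree `lam` to densities of degree `mu` (in coordinates the space does not depend on the degrees,
only the action of vector fields does). -/
def DiffOp (n : ℕ) : Submodule ℂ (Op n) where
  carrier := {A | ∃ q : Symb n, A = coeffOp q}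
  zero_mem' := ⟨0, by simp [coeffOp]⟩
  add_mem' := by
    rintro _ _ ⟨p, rfl⟩ ⟨q, rfl⟩
    refine ⟨p + q, ?_⟩
    classical
    rw [coeffOp_eq_sum (p + q) (p.support ∪ q.support) MvPolynomial.support_add,
      coeffOp_eq_sum p _ Finset.subset_union_left, coeffOp_eq_sum q _ Finset.subset_union_right,
      ← Finset.sum_add_distrib]
    refine Finset.sum_congr rfl fun α _ => ?_
    ext1 φ
    simp [add_mul]
  smul_mem' := by
    rintro c _ ⟨p, rfl⟩
    refine ⟨c • p, ?_⟩
    rw [coeffOp_eq_sum (c • p) p.support MvPolynomial.support_smul, coeffOp, Finset.smul_sum]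
    refine Finset.sum_congr rfl fun α _ => ?_
    ext1 φ
    simp

/-- The identification of symbols with differential operators in the affine chart,
`φ ↦ (2πħ)⁻ⁿ ∫∫ e^{(i/ħ)⟨ξ, x - y⟩} P(y, ξ) φ(y) dy dξ`; for a symbol `P = ∑_α P_α(x) ξ^α` that is
polynomial in `ξ` this is `φ ↦ ∑_α (-iħ)^|α| ∂^α (P_α φ)`. -/
def fourierOp {n : ℕ} (hbar : ℝ) (P : Symb n) : Op n :=
  ∑ α ∈ P.support,
    (-Complex.I * hbar) ^ α.degree • (pdPow α * LinearMap.mulLeft ℂ (P.coeff α))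

/-! ### The action of `sl(n+1, ℝ)` -/

/-- The vector fields `∂/∂xⁱ`, `xⁱ ∂/∂xʲ` and `xⁱ xʲ ∂/∂xʲ` (sum over `j`), which span the
infinitesimal action of `SL(n+1, ℝ)` on `Sⁿ` in affine coordinates. A vector field is the family
of its components. -/
def slFields (n : ℕ) : Set (Fin n → SmoothFn n) :=
  (Set.range fun i : Fin n => Pi.single i (1 : SmoothFn n)) ∪
  (Set.range fun ij : Fin n × Fin n => Pi.single ij.2 (coord ij.1)) ∪
  (Set.range fun i : Fin n => fun j => coord i * coord j)

/-- The Lie derivative of densities of degree `lam`: `Xⁱ ∂ᵢ + lam (∂ᵢ Xⁱ)`. -/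
def lieDens {n : ℕ} (lam : ℝ) (X : Fin n → SmoothFn n) : Op n :=
  ∑ i, LinearMap.mulLeft ℂ (X i) * (pd i).toLinearMap
    + (lam : ℂ) • LinearMap.mulLeft ℂ (∑ i, pd i (X i))

/-- The action of a vector field on symbols with values in densities of degree `delta`:
`Xⁱ ∂/∂xⁱ - (∂ⱼ Xⁱ) ξᵢ ∂/∂ξⱼ + delta (∂ᵢ Xⁱ)`. -/
def lieSymb {n : ℕ} (delta : ℝ) (X : Fin n → SmoothFn n) : Module.End ℂ (Symb n) :=
  ∑ i, mulBy (MvPolynomial.C (X i)) * pdx i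
    - ∑ i, ∑ j, mulBy (MvPolynomial.C (pd j (X i)) * MvPolynomial.X i) * pdxi j
    + (delta : ℂ) • mulBy (MvPolynomial.C (∑ i, pd i (X i)))

/-- The action of a vector field on operators from densities of degree `lam` to densities of
degree `mu`. -/
def lieOp {n : ℕ} (lam mu : ℝ) (X : Fin n → SmoothFn n) (A : Op n) : Op n :=
  lieDens mu X * A - A * lieDens lam X

/-- `Q` is a projectively equivariant quantization map from symbols (twisted by densities of degree
`mu - lam`) to differential operators from `lam`-densities to `mu`-densities: it commutes with the
action of `sl(n+1, ℝ)`, and it is normalized by the principal symbol, i.e. it sends a symbol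
`∑_{|α| = k} P_α ξ^α` to `(-iħ)^k ∑_α P_α ∂^α` plus a differential operator of order `< k`. -/
structure IsProjQuantization {n : ℕ} (lam mu hbar : ℝ) (Q : Symb n →ₗ[ℂ] DiffOp n) : Prop where
  equivariant : ∀ X ∈ slFields n, ∀ P : Symb n,
    (Q (lieSymb (mu - lam) X P) : Op n) = lieOp lam mu X (Q P)
  normalized : ∀ (k : ℕ) (P : Symb n), P.IsHomogeneous k →
    ∃ R : Symb n, (∀ α ∈ R.support, α.degree < k) ∧
      (Q P : Op n) = (-Complex.I * hbar) ^ k • coeffOp P + coeffOp R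

/-- The coefficients `C_m^k` of the quantization map in degree `k`, in the variables `lam` and
`delta = mu - lam`. -/
def quantCoeff (n : ℕ) (lam delta : ℝ) (k : ℕ) : ℕ → ℝ
  | 0 => 1
  | m + 1 => ((k : ℝ) - m - 1 + (n + 1) * lam) /
      ((m + 1) * (2 * k - m - 2 + (n + 1) * (1 - delta))) * quantCoeff n lam delta k m

/-! ### The noncommutative hypergeometric function -/

/-- `(a)_m = a (a + 1) ⋯ (a + m - 1)` for an operator `a`. -/
def poch {n : ℕ} (a : Module.End ℂ (Symb n)) (m : ℕ) : Module.End ℂ (Symb n) :=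
  Polynomial.aeval a (ascPochhammer ℂ m)

/-- The term of index `m` of the hypergeometric series with operator-valued parameters `as`, `bs`
and variable `Z`, the variable being written to the right. (`Ring.inverse` is the inverse of an
invertible operator.) -/
def hypTerm {n : ℕ} (as bs : List (Module.End ℂ (Symb n))) (Z : Module.End ℂ (Symb n)) (m : ℕ) :
    Module.End ℂ (Symb n) :=
  ((m.factorial : ℂ)⁻¹) •
    ((as.map (poch · m)).prod * Ring.inverse (bs.map (poch · m)).prod * Z ^ m)

/-- The hypergeometric series with operator-valued parameters, applied to the symbol `P`. It is
meaningful when the `(b)_m` are invertible and only finitely many terms act nontrivially on `P`. -/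
def hyp {n : ℕ} (as bs : List (Module.End ℂ (Symb n))) (Z : Module.End ℂ (Symb n)) (P : Symb n) :
    Symb n :=
  ∑ᶠ m : ℕ, hypTerm as bs Z m P

/-- The shifted Euler operator `E' = ξᵢ ∂/∂ξᵢ + n/2`. -/
def eulerShift (n : ℕ) : Module.End ℂ (Symb n) := euler n + ((n : ℂ) / 2) • 1

/-- The parameters `A₁, A₂` of the quantization map, with `delta = mu - lam`. -/
def paramsA (n : ℕ) (lam mu : ℝ) : List (Module.End ℂ (Symb n)) :=
  [euler n + (((n : ℂ) + 1) * lam) • 1,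
   (2 : ℂ) • euler n + (((n : ℂ) + 1) * (1 - (mu - lam)) - 1) • 1]

/-- The parameters `B₁, B₂` of the quantization map, with `delta = mu - lam`. -/
def paramsB (n : ℕ) (lam mu : ℝ) : List (Module.End ℂ (Symb n)) :=
  [euler n + (((n : ℂ) + 1) * (1 - (mu - lam)) / 2 - 1 / 2) • 1,
   euler n + (((n : ℂ) + 1) * (1 - (mu - lam)) / 2) • 1]

/-- The variable `Z = iħD/4`. -/
def varZ (n : ℕ) (hbar : ℝ) : Module.End ℂ (Symb n) := (Complex.I * hbar / 4) • divg n

end ProjQuant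

end

open scoped ContDiff

noncomputable section

namespace ProjQuant

open MvPolynomial

/-! ### Partial derivatives of smooth functions -/

/-! Write c = -iħ. Under `fourierOp`, composing an operator on the left or on the right with xⁱ or
with c∂ᵢ acts on its symbol through the Weyl algebra generated by x, ξ, ∂/∂x, ∂/∂ξ: left c∂ᵢ is ξᵢ,
right xⁱ is xⁱ, left xⁱ is xⁱ - c∂/∂ξᵢ, right c∂ᵢ is ξᵢ - c∂/∂xⁱ. The action of vector fields on
operators is therefore computed on symbols. For constant and linear fields it is the action on
symbols; for the i-th quadratic field and half-densities it has the extra term c ∂/∂ξᵢ (𝓔 + (n-1)/2)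
(`lieOp_quad_fourierLin`).

Existence. The divergence D commutes with the constant and linear fields. With the i-th quadratic
field, in degree k, the commutator of D^(m+1) is -(m+1)(2k-m-1+n) ∂/∂ξᵢ D^m
(`divg_pow_lieSymb_quad`). So Σ C_m (iħD)^m intertwines the two actions as soon as C_(m+1)
(m+1)(2k-m-1+n) = (k-m+(n-1)/2) C_m (`confluentLin_lieSymb_quad`), which is the recursion of
`quantCoeff`. In the series Z^m acts first, so the coefficients see degree k-m; with this shift the
recursion is solved by F(2E; E | Z) (`quantCoeff_eq`). The four-parameter series reduces to it by
cancelling a common factor (`hypTerm_params_half`).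

Uniqueness. The difference of two quantizations is equivariant and lowers the order, hence respects
the Casimir operators. On symbols of degree k the Casimir is the scalar 2k(k+n) (`WeylRel.casimir`);
on operators it is triangular with diagonal entries 2d(d+n) in degree d (`casimirLow_eq`). These are
distinct for distinct d, so a symbol of degree less than k cannot have eigenvalue 2k(k+n) unless it
is zero (`eq_zero_of_casimirLow`). -/

theorem pd_comm {n : ℕ} (i j : Fin n) (f : SmoothFn n) : pd i (pd j f) = pd j (pd i f) := by
  have key : ∀ (i j : Fin n) (x : Fin n → ℝ), (pd i (pd j f)).toFun x =
      fderiv ℝ (fderiv ℝ f.toFun) x (Pi.single i 1) (Pi.single j 1) := by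
    intro i j x
    have hd : DifferentiableAt ℝ (fderiv ℝ f.toFun) x :=
      ((f.smooth.fderiv_right (m := ∞) (by simp)).differentiable (by simp)) x
    change fderiv ℝ (fun x => fderiv ℝ f.toFun x (Pi.single j 1)) x (Pi.single i 1) = _
    rw [fderiv_clm_apply hd (differentiableAt_const _)]
    simp
  refine SmoothFn.ext fun x => ?_
  rw [key, key]
  have hs : IsSymmSndFDerivAt ℝ f.toFun x :=
    f.smooth.contDiffAt.isSymmSndFDerivAt (by
      rw [minSmoothness_of_isRCLikeNormedField]; exact WithTop.coe_le_coe.2 (le_top : (2 : ℕ∞) ≤ ⊤))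
  exact hs _ _

theorem pd_coord {n : ℕ} (i j : Fin n) : pd i (coord j : SmoothFn n) = if i = j then 1 else 0 := by
  refine SmoothFn.ext fun x => ?_
  change fderiv ℝ (fun x : Fin n → ℝ => ((x j : ℝ) : ℂ)) x (Pi.single i 1) = _
  have : HasFDerivAt (fun x : Fin n → ℝ => ((x j : ℝ) : ℂ))
      (Complex.ofRealCLM.comp (ContinuousLinearMap.proj (R := ℝ) (φ := fun _ : Fin n => ℝ) j)) x :=
    (Complex.ofRealCLM.comp
      (ContinuousLinearMap.proj (R := ℝ) (φ := fun _ : Fin n => ℝ) j)).hasFDerivAt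
  rw [this.fderiv]
  by_cases h : i = j
  · subst h
    simp
    rfl
  · simp [h, Ne.symm h]
    rfl

/-! ### Linear maps out of the space of symbols -/

section
variable {n : ℕ} {V : Type*} [AddCommGroup V] [Module ℂ V]

/-- Lets sums over different supports be compared on a common finite set, which gives additivity of
`symbLift`. -/
theorem sum_support_eq (g : (Fin n →₀ ℕ) → SmoothFn n →ₗ[ℂ] V) (P : Symb n)
    (s : Finset (Fin n →₀ ℕ)) (h : P.support ⊆ s) :
    ∑ α ∈ P.support, g α (P.coeff α) = ∑ α ∈ s, g α (P.coeff α) :=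
  Finset.sum_subset h fun α _ hα => by rw [notMem_support_iff.mp hα, map_zero]

/-- The linear map on symbols that is given by `g α` on the coefficient of `ξ^α`. -/
def symbLift (g : (Fin n →₀ ℕ) → SmoothFn n →ₗ[ℂ] V) : Symb n →ₗ[ℂ] V where
  toFun P := ∑ α ∈ P.support, g α (P.coeff α)
  map_add' P R := by
    classical
    rw [sum_support_eq g (P + R) (P.support ∪ R.support) support_add,
      sum_support_eq g P _ Finset.subset_union_left, sum_support_eq g R _ Finset.subset_union_right,
      ← Finset.sum_add_distrib]
    simp
  map_smul' c P := by
    rw [sum_support_eq g (c • P) P.support support_smul, RingHom.id_apply, Finset.smul_sum]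
    simp

theorem symbLift_apply (g : (Fin n →₀ ℕ) → SmoothFn n →ₗ[ℂ] V) (P : Symb n) :
    symbLift g P = ∑ α ∈ P.support, g α (P.coeff α) := rfl

theorem symbLift_monomial (g : (Fin n →₀ ℕ) → SmoothFn n →ₗ[ℂ] V) (α : Fin n →₀ ℕ)
    (a : SmoothFn n) : symbLift g (monomial α a) = g α a := by
  classical
  rw [symbLift_apply, sum_support_eq g _ {α} support_monomial_subset]
  simp

theorem symb_linear_ext {L₁ L₂ : Symb n →ₗ[ℂ] V}
    (h : ∀ α a, L₁ (monomial α a) = L₂ (monomial α a)) : L₁ = L₂ := by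
  refine LinearMap.ext fun P => ?_
  induction P using MvPolynomial.induction_on' with
  | monomial α a => exact h α a
  | add p q hp hq => rw [map_add, map_add, hp, hq]

/-- A linear identity on symbols may be checked on functions and is inherited under
multiplication by the `ξᵢ`. -/
theorem symb_linear_ext_mul_X {L₁ L₂ : Symb n →ₗ[ℂ] V} (hC : ∀ a, L₁ (C a) = L₂ (C a))
    (hX : ∀ P i, L₁ P = L₂ P → L₁ (X i * P) = L₂ (X i * P)) : L₁ = L₂ := by
  refine LinearMap.ext fun P => ?_
  induction P using MvPolynomial.induction_on with
  | C a => exact hC a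
  | add p q hp hq => rw [map_add, map_add, hp, hq]
  | mul_X p i hp => rw [mul_comm]; exact hX p i hp

end

/-! ### Commutation rules of the elementary operators on symbols -/

theorem pdx_monomial {n : ℕ} (i : Fin n) (α : Fin n →₀ ℕ) (a : SmoothFn n) :
    pdx i (monomial α a) = monomial α (pd i a) := by
  classical
  ext1 β
  change (∑ γ ∈ (monomial α a).support, monomial γ (pd i ((monomial α a).coeff γ))).coeff β = _
  rw [coeff_sum_monomial_pd, coeff_monomial, coeff_monomial]
  split_ifs <;> simp

theorem coeff_pdx {n : ℕ} (i : Fin n) (P : Symb n) (β : Fin n →₀ ℕ) :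
    (pdx i P).coeff β = pd i (P.coeff β) := coeff_sum_monomial_pd i P β

theorem pdx_C {n : ℕ} (i : Fin n) (a : SmoothFn n) : pdx i (C a) = C (pd i a) :=
  pdx_monomial i 0 a

theorem pdx_X_mul {n : ℕ} (i j : Fin n) (P : Symb n) : pdx i (X j * P) = X j * pdx i P := by
  classical
  ext1 β
  rw [coeff_pdx, coeff_X_mul', coeff_X_mul', coeff_pdx]
  split_ifs <;> simp

theorem pdx_C_mul {n : ℕ} (i : Fin n) (f : SmoothFn n) (P : Symb n) :
    pdx i (C f * P) = C f * pdx i P + C (pd i f) * P := by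
  ext1 β
  rw [coeff_pdx, coeff_add, coeff_C_mul, coeff_C_mul, coeff_C_mul, coeff_pdx, Derivation.leibniz]
  simp [mul_comm]

theorem pdxi_apply {n : ℕ} (i : Fin n) (P : Symb n) : pdxi i P = pderiv i P := rfl

theorem pdxi_C_mul {n : ℕ} (i : Fin n) (f : SmoothFn n) (P : Symb n) :
    pdxi i (C f * P) = C f * pdxi i P := by
  simp [pdxi_apply]

theorem pdxi_X_mul {n : ℕ} (i j : Fin n) (P : Symb n) :
    pdxi i (X j * P) = X j * pdxi i P + if i = j then P else 0 := by
  classical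
  rw [pdxi_apply, pdxi_apply, Derivation.leibniz, pderiv_X]
  by_cases h : i = j
  · subst h; simp
  · simp [h, Ne.symm h]

theorem pdx_pdx_comm {n : ℕ} (i j : Fin n) (P : Symb n) : pdx i (pdx j P) = pdx j (pdx i P) := by
  ext1 β
  simp only [coeff_pdx, pd_comm i j]

theorem pdxi_pdxi_comm {n : ℕ} (i j : Fin n) (P : Symb n) :
    pdxi i (pdxi j P) = pdxi j (pdxi i P) := by
  have : pdxi i * pdxi j = pdxi j * (pdxi i : Module.End ℂ (Symb n)) := by
    refine symb_linear_ext_mul_X (fun a => ?_) (fun P l hP => ?_)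
    · simp [pdxi_apply]
    · simp only [Module.End.mul_apply] at hP ⊢
      simp only [pdxi_X_mul, map_add, hP]
      split_ifs <;> simp [add_comm, add_left_comm]
  exact LinearMap.congr_fun this P

theorem pdx_pdxi_comm {n : ℕ} (i j : Fin n) (P : Symb n) :
    pdx i (pdxi j P) = pdxi j (pdx i P) := by
  have : pdx i * pdxi j = pdxi j * (pdx i : Module.End ℂ (Symb n)) := by
    refine symb_linear_ext_mul_X (fun a => ?_) (fun P l hP => ?_)
    · simp [pdxi_apply, pdx_C]
    · simp only [Module.End.mul_apply] at hP ⊢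
      simp only [pdxi_X_mul, pdx_X_mul, map_add, hP]
      split_ifs <;> simp
  exact LinearMap.congr_fun this P

/-! ### Products of partial derivatives -/

theorem prod_ofFn_pow_add {M : Type*} [Monoid M] : ∀ {n : ℕ} (a : Fin n → M)
    (_ : ∀ i j, Commute (a i) (a j)) (f g : Fin n → ℕ),
    (List.ofFn fun i => a i ^ (f i + g i)).prod =
      (List.ofFn fun i => a i ^ f i).prod * (List.ofFn fun i => a i ^ g i).prod
  | 0, _, _, _, _ => by simp
  | n + 1, a, h, f, g => by
    -- The list product is ordered; the only reordering needed moves the second power of the first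
    -- factor past the powers of the later ones.
    have hc : Commute (a 0 ^ g 0) (List.ofFn fun i : Fin n => a i.succ ^ f i.succ).prod := by
      refine Commute.list_prod_right _ _ fun b hb => ?_
      obtain ⟨i, rfl⟩ := (List.mem_ofFn' _ _).mp hb
      exact (h _ _).pow_pow _ _
    simp only [List.ofFn_succ, List.prod_cons]
    rw [prod_ofFn_pow_add (fun i => a i.succ) (fun i j => h _ _) (fun i => f i.succ)
      (fun i => g i.succ), pow_add]
    simp only [mul_assoc]
    rw [← mul_assoc (a 0 ^ g 0), hc.eq, mul_assoc]

theorem pdPow_add {n : ℕ} (α β : Fin n →₀ ℕ) : pdPow (α + β) = pdPow α * pdPow β :=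
  prod_ofFn_pow_add (fun i => ((pd i).toLinearMap : Op n))
    (fun i j => LinearMap.ext fun f => pd_comm i j f) α β

theorem prod_ofFn_ite {M : Type*} [Monoid M] : ∀ {n : ℕ} (i : Fin n) (b : M),
    (List.ofFn fun j => if j = i then b else 1).prod = b
  | 0, i, _ => i.elim0
  | n + 1, i, b => by
    rw [List.ofFn_succ, List.prod_cons]
    refine Fin.cases ?_ (fun i => ?_) i
    · simp [Fin.succ_ne_zero]
    · simp only [Fin.succ_inj]
      rw [prod_ofFn_ite i b, if_neg (Fin.succ_ne_zero i).symm, one_mul]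

theorem pdPow_single {n : ℕ} (i : Fin n) :
    pdPow (Finsupp.single i 1) = ((pd i).toLinearMap : Op n) := by
  rw [pdPow, ← prod_ofFn_ite i ((pd i).toLinearMap : Op n)]
  congr 2
  ext1 j
  by_cases h : j = i
  · subst h; simp
  · simp [h]

theorem pdPow_zero {n : ℕ} : pdPow (0 : Fin n →₀ ℕ) = 1 := by
  simp [pdPow]

theorem mulBy_apply {n : ℕ} (a P : Symb n) : mulBy a P = a * P := rfl

/-! ### The identification of symbols with operators in the chart -/

/-- `fourierOp` as a linear map. -/
def fourierLin (n : ℕ) (hbar : ℝ) : Symb n →ₗ[ℂ] Op n :=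
  symbLift fun α =>
    (-Complex.I * hbar) ^ α.degree •
      (LinearMap.mulLeft ℂ (pdPow α) ∘ₗ LinearMap.mul ℂ (SmoothFn n))

/-- `coeffOp` as a linear map. -/
def coeffLin (n : ℕ) : Symb n →ₗ[ℂ] Op n :=
  symbLift fun α => LinearMap.mulRight ℂ (pdPow α) ∘ₗ LinearMap.mul ℂ (SmoothFn n)

theorem coeffLin_apply {n : ℕ} (P : Symb n) : coeffLin n P = coeffOp P := rfl

theorem fourierLin_monomial {n : ℕ} (hbar : ℝ) (α : Fin n →₀ ℕ) (a : SmoothFn n) :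
    fourierLin n hbar (monomial α a) =
      (-Complex.I * hbar) ^ α.degree • (pdPow α * LinearMap.mulLeft ℂ a) :=
  symbLift_monomial _ _ _

theorem coeffLin_monomial {n : ℕ} (α : Fin n →₀ ℕ) (a : SmoothFn n) :
    coeffLin n (monomial α a) = LinearMap.mulLeft ℂ a * pdPow α :=
  symbLift_monomial _ _ _

theorem fourierLin_C {n : ℕ} (hbar : ℝ) (a : SmoothFn n) :
    fourierLin n hbar (C a) = LinearMap.mulLeft ℂ a := by
  rw [C_apply, fourierLin_monomial]; simp [pdPow_zero]

theorem coeffLin_C {n : ℕ} (a : SmoothFn n) : coeffLin n (C a) = LinearMap.mulLeft ℂ a := by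
  rw [C_apply, coeffLin_monomial]; simp [pdPow_zero]

theorem X_mul_monomial {n : ℕ} (i : Fin n) (α : Fin n →₀ ℕ) (a : SmoothFn n) :
    X i * monomial α a = monomial (Finsupp.single i 1 + α) a := by
  rw [X, monomial_mul, one_mul]

theorem pd_mul_mulLeft {n : ℕ} (i : Fin n) (a : SmoothFn n) :
    ((pd i).toLinearMap : Op n) * LinearMap.mulLeft ℂ a =
      LinearMap.mulLeft ℂ a * (pd i).toLinearMap + LinearMap.mulLeft ℂ (pd i a) := by
  refine LinearMap.ext fun f => ?_
  change pd i (a * f) = a * pd i f + pd i a * f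
  rw [Derivation.leibniz, smul_eq_mul, smul_eq_mul, mul_comm f]

theorem pd_mul_pd {n : ℕ} (i j : Fin n) :
    ((pd i).toLinearMap : Op n) * (pd j).toLinearMap = (pd j).toLinearMap * (pd i).toLinearMap :=
  LinearMap.ext fun f => pd_comm i j f

/-- Derivatives stand to the left of the coefficients in `fourierOp`, so an extra ξᵢ is an extra c∂ᵢ
on the far left. -/
theorem fourierLin_X_mul {n : ℕ} (hbar : ℝ) (i : Fin n) (P : Symb n) :
    fourierLin n hbar (X i * P) =
      (-Complex.I * hbar) • ((pd i).toLinearMap * fourierLin n hbar P) := by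
  have : fourierLin n hbar ∘ₗ mulBy (X i) = (-Complex.I * hbar) •
      (LinearMap.mulLeft ℂ ((pd i).toLinearMap : Op n) ∘ₗ fourierLin n hbar) := by
    refine symb_linear_ext fun α a => ?_
    simp only [LinearMap.comp_apply, LinearMap.smul_apply, mulBy_apply, LinearMap.mulLeft_apply]
    rw [X_mul_monomial, fourierLin_monomial, fourierLin_monomial, pdPow_add, pdPow_single,
      map_add, Finsupp.degree_single, pow_add, pow_one, mul_smul, mul_assoc, mul_smul_comm]
  exact LinearMap.congr_fun this P

/-- In the opposite ordering the derivatives stand on the right, and so does the extra ∂ᵢ. -/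
theorem coeffLin_X_mul {n : ℕ} (i : Fin n) (P : Symb n) :
    coeffLin n (X i * P) = coeffLin n P * (pd i).toLinearMap := by
  have : coeffLin n ∘ₗ mulBy (X i) =
      LinearMap.mulRight ℂ ((pd i).toLinearMap : Op n) ∘ₗ coeffLin n := by
    refine symb_linear_ext fun α a => ?_
    simp only [LinearMap.comp_apply, mulBy_apply, LinearMap.mulRight_apply]
    rw [X_mul_monomial, coeffLin_monomial, coeffLin_monomial, add_comm, pdPow_add, pdPow_single,
      mul_assoc]
  exact LinearMap.congr_fun this P

theorem pd_mul_coeffLin {n : ℕ} (i : Fin n) (P : Symb n) :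
    ((pd i).toLinearMap : Op n) * coeffLin n P = coeffLin n (X i * P + pdx i P) := by
  have : LinearMap.mulLeft ℂ ((pd i).toLinearMap : Op n) ∘ₗ coeffLin n =
      coeffLin n ∘ₗ (mulBy (X i) + pdx i) := by
    refine symb_linear_ext_mul_X (fun a => ?_) (fun P j hP => ?_)
    · simp only [LinearMap.comp_apply, LinearMap.add_apply, mulBy_apply, LinearMap.mulLeft_apply]
      rw [map_add, coeffLin_X_mul, pdx_C, coeffLin_C, coeffLin_C, pd_mul_mulLeft]
    · simp only [LinearMap.comp_apply, LinearMap.add_apply, mulBy_apply, LinearMap.mulLeft_apply] at hP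
      simp only [LinearMap.comp_apply, LinearMap.add_apply, mulBy_apply, LinearMap.mulLeft_apply]
      rw [pdx_X_mul, mul_left_comm, ← mul_add, coeffLin_X_mul, coeffLin_X_mul, ← hP, mul_assoc]
  exact LinearMap.congr_fun this P

theorem fourierLin_C_mul {n : ℕ} (hbar : ℝ) (f : SmoothFn n) (P : Symb n) :
    fourierLin n hbar (C f * P) = fourierLin n hbar P * LinearMap.mulLeft ℂ f := by
  have : fourierLin n hbar ∘ₗ mulBy (C f) =
      LinearMap.mulRight ℂ (LinearMap.mulLeft ℂ f : Op n) ∘ₗ fourierLin n hbar := by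
    refine symb_linear_ext fun α a => ?_
    simp only [LinearMap.comp_apply, mulBy_apply, LinearMap.mulRight_apply]
    rw [C_mul_monomial, fourierLin_monomial, fourierLin_monomial, mul_comm f a, smul_mul_assoc,
      mul_assoc, LinearMap.mulLeft_mul]
    rfl
  exact LinearMap.congr_fun this P

/-- ∂ᵢ commutes with every ∂^α, so the commutator only differentiates the coefficients. -/
theorem fourierLin_pdx {n : ℕ} (hbar : ℝ) (i : Fin n) (P : Symb n) :
    fourierLin n hbar (pdx i P) =
      (pd i).toLinearMap * fourierLin n hbar P - fourierLin n hbar P * (pd i).toLinearMap := by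
  have : fourierLin n hbar ∘ₗ pdx i =
      LinearMap.mulLeft ℂ ((pd i).toLinearMap : Op n) ∘ₗ fourierLin n hbar -
        LinearMap.mulRight ℂ ((pd i).toLinearMap : Op n) ∘ₗ fourierLin n hbar := by
    refine symb_linear_ext_mul_X (fun a => ?_) (fun P j hP => ?_)
    · simp only [LinearMap.comp_apply, LinearMap.sub_apply,
        LinearMap.mulLeft_apply, LinearMap.mulRight_apply]
      rw [pdx_C, fourierLin_C, fourierLin_C, pd_mul_mulLeft, add_sub_cancel_left]
    · simp only [LinearMap.comp_apply, LinearMap.sub_apply,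
        LinearMap.mulLeft_apply, LinearMap.mulRight_apply] at hP
      simp only [LinearMap.comp_apply, LinearMap.sub_apply,
        LinearMap.mulLeft_apply, LinearMap.mulRight_apply]
      rw [pdx_X_mul, fourierLin_X_mul, fourierLin_X_mul, hP, mul_smul_comm, smul_mul_assoc,
        mul_sub, smul_sub, ← mul_assoc, ← mul_assoc, ← mul_assoc, pd_mul_pd]
  exact LinearMap.congr_fun this P

/-- Commuting with xⁱ removes one factor c∂ᵢ at a time. The factor c is kept on the left, so no
division by ħ is needed. -/
theorem fourierLin_pdxi {n : ℕ} (hbar : ℝ) (i : Fin n) (P : Symb n) :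
    (-Complex.I * hbar) • fourierLin n hbar (pdxi i P) =
      fourierLin n hbar P * LinearMap.mulLeft ℂ (coord i)
        - LinearMap.mulLeft ℂ (coord i) * fourierLin n hbar P := by
  have : (-Complex.I * hbar) • (fourierLin n hbar ∘ₗ pdxi i) =
      LinearMap.mulRight ℂ (LinearMap.mulLeft ℂ (coord i) : Op n) ∘ₗ fourierLin n hbar -
        LinearMap.mulLeft ℂ (LinearMap.mulLeft ℂ (coord i) : Op n) ∘ₗ fourierLin n hbar := by
    refine symb_linear_ext_mul_X (fun a => ?_) (fun P j hP => ?_)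
    · simp only [LinearMap.comp_apply, LinearMap.smul_apply, LinearMap.sub_apply,
        LinearMap.mulLeft_apply, LinearMap.mulRight_apply]
      rw [pdxi_apply, pderiv_C, map_zero, smul_zero, fourierLin_C, eq_comm, sub_eq_zero]
      refine LinearMap.ext fun f => ?_
      exact mul_left_comm _ _ _
    · simp only [LinearMap.comp_apply, LinearMap.smul_apply, LinearMap.sub_apply,
        LinearMap.mulLeft_apply, LinearMap.mulRight_apply] at hP
      simp only [LinearMap.comp_apply, LinearMap.smul_apply, LinearMap.sub_apply,
        LinearMap.mulLeft_apply, LinearMap.mulRight_apply]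
      -- The canonical commutation relation, the source of the Kronecker delta in `pdxi_X_mul`.
      have hx : LinearMap.mulLeft ℂ (coord i) * ((pd j).toLinearMap : Op n) =
          (pd j).toLinearMap * LinearMap.mulLeft ℂ (coord i) - if i = j then 1 else 0 := by
        rw [pd_mul_mulLeft, pd_coord, eq_sub_iff_add_eq]
        by_cases h : i = j
        · subst h
          rw [if_pos rfl, if_pos rfl, LinearMap.mulLeft_one]
          rfl
        · rw [if_neg h, if_neg (Ne.symm h), add_zero, LinearMap.mulLeft_zero_eq_zero, add_zero]
      have hy : LinearMap.mulLeft ℂ (coord i) * ((pd j).toLinearMap * fourierLin n hbar P) =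
          (pd j).toLinearMap * (LinearMap.mulLeft ℂ (coord i) * fourierLin n hbar P)
            - fourierLin n hbar (if i = j then P else 0) := by
        rw [← mul_assoc, hx, sub_mul, mul_assoc]
        split_ifs
        · rw [one_mul]
        · rw [zero_mul, map_zero]
      rw [pdxi_X_mul, map_add, fourierLin_X_mul, fourierLin_X_mul, smul_add, ← mul_smul_comm, hP,
        mul_smul_comm, hy, smul_mul_assoc, mul_sub, smul_sub, smul_sub, mul_assoc]
      abel
  exact LinearMap.congr_fun this P

/-! ### Computations in a Weyl algebra -/

/-- The relations between positions `x`, momenta `y` and the derivatives `p = ∂/∂x`,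
`q = ∂/∂y`. -/
structure WeylRel {ι A : Type*} [DecidableEq ι] [Ring A] (x y p q : ι → A) : Prop where
  xx : ∀ i j, x i * x j = x j * x i
  yx : ∀ i j, y i * x j = x j * y i
  qx : ∀ i j, q i * x j = x j * q i
  py : ∀ i j, p i * y j = y j * p i
  pp : ∀ i j, p i * p j = p j * p i
  qq : ∀ i j, q i * q j = q j * q i
  qp : ∀ i j, q i * p j = p j * q i
  px : ∀ i j, p i * x j = x j * p i + if i = j then 1 else 0
  qy : ∀ i j, q i * y j = y j * q i + if i = j then 1 else 0

namespace WeylRel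

variable {ι A : Type*} [DecidableEq ι] [Fintype ι] [Ring A] {x y p q : ι → A}

theorem swap_pos (h : WeylRel x y p q) (i : ι) :
    (∑ j, x j * p j) * x i = x i * (∑ j, x j * p j) + x i := by
  rw [Finset.sum_mul, Finset.mul_sum]
  simp only [mul_assoc, h.px, mul_add, mul_ite, mul_one, mul_zero, Finset.sum_add_distrib,
    Finset.sum_ite_eq', Finset.mem_univ, if_true]
  simp only [← mul_assoc, h.xx i]

theorem swap_mom (h : WeylRel x y p q) (i : ι) :
    q i * (∑ j, y j * q j) = (∑ j, y j * q j) * q i + q i := by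
  rw [Finset.sum_mul, Finset.mul_sum]
  simp only [← mul_assoc, h.qy, add_mul, ite_mul, one_mul, zero_mul, Finset.sum_add_distrib,
    Finset.sum_ite_eq, Finset.mem_univ, if_true]
  simp only [mul_assoc, h.qq i]

theorem p_mul_eulerPos (h : WeylRel x y p q) (i : ι) :
    p i * (∑ j, x j * p j) = (∑ j, x j * p j) * p i + p i := by
  rw [Finset.sum_mul, Finset.mul_sum]
  simp only [← mul_assoc, h.px, add_mul, ite_mul, one_mul, zero_mul, Finset.sum_add_distrib,
    Finset.sum_ite_eq, Finset.mem_univ, if_true]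
  simp only [mul_assoc, h.pp i]

theorem sum_px (h : WeylRel x y p q) :
    ∑ j, p j * x j = ∑ j, x j * p j + (Fintype.card ι : A) := by
  simp [h.px, Finset.sum_add_distrib]

theorem sum_qy (h : WeylRel x y p q) :
    ∑ j, q j * y j = ∑ j, y j * q j + (Fintype.card ι : A) := by
  simp [h.qy, Finset.sum_add_distrib]

theorem eulerMom_x (h : WeylRel x y p q) (i : ι) :
    (∑ j, y j * q j) * x i = x i * ∑ j, y j * q j := by
  rw [Finset.sum_mul, Finset.mul_sum]
  refine Finset.sum_congr rfl fun j _ => ?_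
  rw [mul_assoc, h.qx, ← mul_assoc, h.yx, mul_assoc]

theorem eulerMom_p (h : WeylRel x y p q) (i : ι) :
    (∑ j, y j * q j) * p i = p i * ∑ j, y j * q j := by
  rw [Finset.sum_mul, Finset.mul_sum]
  refine Finset.sum_congr rfl fun j _ => ?_
  rw [mul_assoc, h.qp, ← mul_assoc, ← h.py, mul_assoc]

theorem eulerMom_y (h : WeylRel x y p q) (hyy : ∀ i j, y i * y j = y j * y i) (i : ι) :
    (∑ j, y j * q j) * y i = y i * (∑ j, y j * q j) + y i := by
  rw [Finset.sum_mul, Finset.mul_sum]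
  simp only [mul_assoc, h.qy, mul_add, mul_ite, mul_one, mul_zero, Finset.sum_add_distrib,
    Finset.sum_ite_eq', Finset.mem_univ, if_true]
  simp only [← mul_assoc, hyy i]

theorem q_mul_pairing (h : WeylRel x y p q) (i : ι) :
    q i * (∑ j, x j * y j) = (∑ j, x j * y j) * q i + x i := by
  rw [Finset.sum_mul, Finset.mul_sum]
  simp only [← mul_assoc, h.qx]
  simp only [mul_assoc, h.qy, mul_add, mul_ite, mul_one, mul_zero, Finset.sum_add_distrib,
    Finset.sum_ite_eq, Finset.mem_univ, if_true]

theorem pairing_x (h : WeylRel x y p q) (i : ι) :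
    (∑ j, x j * y j) * x i = x i * ∑ j, x j * y j := by
  rw [Finset.sum_mul, Finset.mul_sum]
  refine Finset.sum_congr rfl fun j _ => ?_
  rw [mul_assoc, h.yx, ← mul_assoc, h.xx, mul_assoc]

theorem div_x (h : WeylRel x y p q) (i : ι) :
    (∑ j, p j * q j) * x i = x i * (∑ j, p j * q j) + q i := by
  rw [Finset.sum_mul, Finset.mul_sum]
  simp only [mul_assoc, h.qx]
  simp only [← mul_assoc, h.px, add_mul, ite_mul, one_mul, zero_mul, Finset.sum_add_distrib,
    Finset.sum_ite_eq', Finset.mem_univ, if_true]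

theorem div_p (h : WeylRel x y p q) (i : ι) :
    (∑ j, p j * q j) * p i = p i * ∑ j, p j * q j := by
  rw [Finset.sum_mul, Finset.mul_sum]
  refine Finset.sum_congr rfl fun j _ => ?_
  rw [mul_assoc, h.qp, ← mul_assoc, h.pp, mul_assoc]

theorem div_q (h : WeylRel x y p q) (i : ι) :
    (∑ j, p j * q j) * q i = q i * ∑ j, p j * q j := by
  rw [Finset.sum_mul, Finset.mul_sum]
  refine Finset.sum_congr rfl fun j _ => ?_
  rw [mul_assoc, h.qq, ← mul_assoc, ← h.qp, mul_assoc]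

theorem div_y (h : WeylRel x y p q) (i : ι) :
    (∑ j, p j * q j) * y i = y i * (∑ j, p j * q j) + p i := by
  rw [Finset.sum_mul, Finset.mul_sum]
  simp only [mul_assoc, h.qy, mul_add, mul_ite, mul_one, mul_zero, Finset.sum_add_distrib,
    Finset.sum_ite_eq', Finset.mem_univ, if_true]
  simp only [← mul_assoc, h.py]

theorem div_eulerPos (h : WeylRel x y p q) :
    (∑ j, p j * q j) * (∑ j, x j * p j) =
      (∑ j, x j * p j) * (∑ j, p j * q j) + ∑ j, p j * q j := by
  rw [Finset.mul_sum]
  simp only [← mul_assoc, h.div_x, add_mul]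
  simp only [mul_assoc, h.div_p, Finset.sum_add_distrib, h.qp]
  rw [Finset.sum_mul]
  simp only [mul_assoc]

theorem div_eulerMom (h : WeylRel x y p q) :
    (∑ j, p j * q j) * (∑ j, y j * q j) =
      (∑ j, y j * q j) * (∑ j, p j * q j) + ∑ j, p j * q j := by
  rw [Finset.mul_sum]
  simp only [← mul_assoc, h.div_y, add_mul]
  simp only [mul_assoc, h.div_q, Finset.sum_add_distrib]
  rw [Finset.sum_mul]
  simp only [mul_assoc]

/-- The divergence and the pairing Σ xʲyⱼ are the lowering and raising elements of an sl₂-triple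
whose weight element is the sum of the two Euler operators and the dimension. -/
theorem div_pairing (h : WeylRel x y p q) :
    (∑ j, p j * q j) * (∑ j, x j * y j) = (∑ j, x j * y j) * (∑ j, p j * q j)
      + ∑ j, x j * p j + ∑ j, y j * q j + (Fintype.card ι : A) := by
  rw [Finset.mul_sum]
  simp only [← mul_assoc, h.div_x, add_mul]
  simp only [mul_assoc, h.div_y, Finset.sum_add_distrib, h.sum_qy, mul_add]
  rw [Finset.sum_mul]
  simp only [mul_assoc]
  abel

/-- The action on symbols of the quadratic vector field `xⁱ xʲ ∂/∂xʲ`. -/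
def quad (x y p q : ι → A) (i : ι) : A :=
  x i * (∑ j, x j * p j) - x i * (∑ j, y j * q j) - (∑ j, x j * y j) * q i

/-- The divergence does not commute with the quadratic vector fields. -/
theorem div_quad (h : WeylRel x y p q) (i : ι) :
    (∑ j, p j * q j) * quad x y p q i = quad x y p q i * (∑ j, p j * q j)
      - q i * (2 * (∑ j, y j * q j) + (Fintype.card ι : A) - 1) := by
  have hc : q i * (Fintype.card ι : A) = (Fintype.card ι : A) * q i :=
    ((Nat.cast_commute _ _).eq).symm
  have hxq : q i * (∑ j, x j * p j) = (∑ j, x j * p j) * q i := by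
    rw [Finset.sum_mul, Finset.mul_sum]
    refine Finset.sum_congr rfl fun j _ => ?_
    rw [← mul_assoc, h.qx, mul_assoc, h.qp, mul_assoc]
  have h1 := h.div_x i
  have h2 := h.div_q i
  have h3 := h.div_eulerPos
  have h4 := h.div_eulerMom
  have h5 := h.div_pairing
  have h6 := h.swap_mom i
  unfold quad
  -- From here on the identity is a formal consequence of the commutators collected above.
  generalize (∑ j, p j * q j) = D at *
  generalize (∑ j, x j * p j) = E at *
  generalize (∑ j, y j * q j) = e at *
  generalize (∑ j, x j * y j) = S at *
  generalize (Fintype.card ι : A) = N at *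
  simp only [mul_sub, sub_mul, ← mul_assoc, h1, h5, add_mul]
  simp only [mul_assoc, h2, h3, h4, mul_add, hc, hxq, mul_one]
  rw [show q i * (2 * e) = q i * e + q i * e by rw [two_mul, mul_add], h6]
  noncomm_ring

/-- The commutator of the left and right multiplications by the operator `xⁱ xʲ ∂/∂xʲ` in the
symbol calculus. -/
theorem quad_star [Algebra ℂ A] (h : WeylRel x y p q) (c : ℂ) (i : ι) :
    (∑ j, (x i - c • q i) * (x j - c • q j) * y j) - (∑ j, (y j - c • p j) * x j * x i) =
      c • (quad x y p q i
        + c • (q i * ((∑ j, y j * q j) + (Fintype.card ι : A)))) := by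
  -- A factor with the free index comes out of each sum. Reordering qⱼyⱼ, and pⱼxⱼ in `e2`, into
  -- Euler operators produces the dimension.
  have e1 : ∑ j, (x i - c • q i) * (x j - c • q j) * y j = (x i - c • q i) *
      ((∑ j, x j * y j) - c • ((∑ j, y j * q j) + (Fintype.card ι : A))) := by
    rw [← h.sum_qy, Finset.smul_sum, ← Finset.sum_sub_distrib, Finset.mul_sum]
    simp only [mul_assoc, sub_mul, smul_mul_assoc]
  have e2 : ∑ j, (y j - c • p j) * x j * x i =
      ((∑ j, x j * y j) - c • ((∑ j, x j * p j) + (Fintype.card ι : A))) * x i := by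
    rw [← h.sum_px, Finset.smul_sum, ← Finset.sum_sub_distrib, Finset.sum_mul]
    simp only [sub_mul, smul_mul_assoc, h.yx]
  rw [e1, e2]
  have hc : (Fintype.card ι : A) * x i = x i * (Fintype.card ι : A) :=
    (Nat.cast_commute _ _).eq
  have h1 := h.q_mul_pairing i
  have h2 := h.swap_pos i
  have h3 := h.pairing_x i
  unfold quad
  generalize (∑ j, x j * p j) = E at *
  generalize (∑ j, y j * q j) = e at *
  generalize (∑ j, x j * y j) = S at *
  generalize (Fintype.card ι : A) = N at *
  simp only [mul_sub, sub_mul, mul_add, add_mul, smul_mul_assoc, mul_smul_comm, h1, h2, h3, hc]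
  module

/-- The Casimir operator of the projective action on symbols. -/
theorem casimir (h : WeylRel x y p q) :
    (∑ i, ∑ j, (x i * p j - y j * q i) * (x j * p i - y i * q j))
      - 2 * (∑ i, quad x y p q i * p i)
      + (∑ i, (x i * p i - y i * q i)) * (∑ i, (x i * p i - y i * q i))
      - ((Fintype.card ι : A) + 1) * (∑ i, (x i * p i - y i * q i)) =
    2 * ((∑ j, y j * q j) * ((∑ j, y j * q j) + (Fintype.card ι : A))) := by
  have hN : ∀ a : A, a * (Fintype.card ι : A) = (Fintype.card ι : A) * a := fun a =>
    ((Nat.cast_commute _ _).eq).symm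
  have h1 : ∑ i, x i * ((∑ j, x j * p j) * p i) =
      (∑ j, x j * p j) * (∑ j, x j * p j) - ∑ j, x j * p j := by
    rw [Finset.sum_mul Finset.univ (fun i => x i * p i), ← Finset.sum_sub_distrib]
    refine Finset.sum_congr rfl fun i _ => ?_
    rw [mul_assoc, h.p_mul_eulerPos, mul_add, add_sub_cancel_right]
  have h1' : ∑ i, y i * ((∑ j, y j * q j) * q i) =
      (∑ j, y j * q j) * (∑ j, y j * q j) - ∑ j, y j * q j := by
    rw [Finset.sum_mul Finset.univ (fun i => y i * q i), ← Finset.sum_sub_distrib]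
    refine Finset.sum_congr rfl fun i _ => ?_
    rw [mul_assoc, h.swap_mom, mul_add, add_sub_cancel_right]
  have h2 : ∑ i, x i * ((∑ j, y j * q j) * p i) = (∑ j, x j * p j) * ∑ j, y j * q j := by
    rw [Finset.sum_mul]
    refine Finset.sum_congr rfl fun i _ => ?_
    rw [h.eulerMom_p, mul_assoc]
  have h2' : (∑ j, y j * q j) * (∑ j, x j * p j) = (∑ j, x j * p j) * ∑ j, y j * q j := by
    rw [Finset.mul_sum _ _ (∑ j, y j * q j), Finset.sum_mul]
    refine Finset.sum_congr rfl fun i _ => ?_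
    rw [← mul_assoc, h.eulerMom_x, mul_assoc, h.eulerMom_p, mul_assoc]
  have h3 : ∑ i, quad x y p q i * p i = (∑ j, x j * p j) * (∑ j, x j * p j) - ∑ j, x j * p j
      - (∑ j, x j * p j) * (∑ j, y j * q j) - (∑ j, x j * y j) * ∑ j, p j * q j := by
    rw [← h1, ← h2, Finset.mul_sum _ _ (∑ j, x j * y j), ← Finset.sum_sub_distrib,
      ← Finset.sum_sub_distrib]
    refine Finset.sum_congr rfl fun i _ => ?_
    simp only [quad, sub_mul, mul_assoc, h.qp]
  -- The mixed terms each sum to the pairing times the divergence; the resulting -2SD cancels the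
  -- +2SD that `h3` contributes.
  have h4 : ∑ i, ∑ j, (x i * p j - y j * q i) * (x j * p i - y i * q j) =
      (∑ i, x i * ((∑ j, x j * p j + (Fintype.card ι : A)) * p i))
      + (∑ i, y i * ((∑ j, y j * q j + (Fintype.card ι : A)) * q i))
      - 2 * ((∑ j, x j * y j) * ∑ j, p j * q j) := by
    have a1 : ∑ i, x i * ((∑ j, x j * p j + (Fintype.card ι : A)) * p i) =
        ∑ i, ∑ j, x i * p j * (x j * p i) := by
      refine Finset.sum_congr rfl fun i _ => ?_
      rw [← h.sum_px, Finset.sum_mul, Finset.mul_sum]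
      simp only [mul_assoc]
    have a2 : ∑ i, y i * ((∑ j, y j * q j + (Fintype.card ι : A)) * q i) =
        ∑ i, ∑ j, y j * q i * (y i * q j) := by
      rw [Finset.sum_comm]
      refine Finset.sum_congr rfl fun i _ => ?_
      rw [← h.sum_qy, Finset.sum_mul, Finset.mul_sum]
      simp only [mul_assoc]
    have a3 : (∑ j, x j * y j) * ∑ j, p j * q j = ∑ i, ∑ j, x i * p j * (y i * q j) := by
      rw [Finset.sum_mul_sum]
      refine Finset.sum_congr rfl fun i _ => Finset.sum_congr rfl fun j _ => ?_
      rw [mul_assoc, ← mul_assoc (y i), ← h.py, mul_assoc, mul_assoc]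
    have a4 : (∑ j, x j * y j) * ∑ j, p j * q j = ∑ i, ∑ j, y j * q i * (x j * p i) := by
      rw [Finset.sum_comm, Finset.sum_mul_sum]
      refine Finset.sum_congr rfl fun i _ => Finset.sum_congr rfl fun j _ => ?_
      rw [mul_assoc (y i), ← mul_assoc (q j), h.qx, mul_assoc (x i) (q j), h.qp, ← mul_assoc (y i),
        h.yx]
    rw [two_mul, a1, a2]
    nth_rewrite 1 [a3]
    rw [a4]
    simp only [← Finset.sum_add_distrib, ← Finset.sum_sub_distrib]
    refine Finset.sum_congr rfl fun i _ => Finset.sum_congr rfl fun j _ => ?_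
    noncomm_ring
  have h5 : ∑ i, x i * ((∑ j, x j * p j + (Fintype.card ι : A)) * p i) =
      (∑ j, x j * p j) * (∑ j, x j * p j) - (∑ j, x j * p j)
        + (Fintype.card ι : A) * ∑ j, x j * p j := by
    rw [← h1, Finset.mul_sum, ← Finset.sum_add_distrib]
    refine Finset.sum_congr rfl fun i _ => ?_
    rw [add_mul, mul_add, ← mul_assoc _ (Fintype.card ι : A), hN, mul_assoc _ (x i)]
  have h5' : ∑ i, y i * ((∑ j, y j * q j + (Fintype.card ι : A)) * q i) =
      (∑ j, y j * q j) * (∑ j, y j * q j) - (∑ j, y j * q j)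
        + (Fintype.card ι : A) * ∑ j, y j * q j := by
    rw [← h1', Finset.mul_sum, ← Finset.sum_add_distrib]
    refine Finset.sum_congr rfl fun i _ => ?_
    rw [add_mul, mul_add, ← mul_assoc _ (Fintype.card ι : A), hN, mul_assoc _ (y i)]
  rw [h4, h3, h5, h5', Finset.sum_sub_distrib, mul_add (∑ j, y j * q j), hN]
  simp only [mul_sub, sub_mul, h2']
  generalize (∑ j, p j * q j) = D
  generalize (∑ j, x j * p j) = E
  generalize (∑ j, y j * q j) = e
  generalize (∑ j, x j * y j) = S
  generalize (Fintype.card ι : A) = N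
  noncomm_ring

end WeylRel

/-! ### The projective action on symbols and on operators -/

/-- Makes the formal identities of the Weyl algebra available as identities between operators on
symbols. -/
theorem weylRel_symb (n : ℕ) : WeylRel (fun i : Fin n => mulBy (C (coord i)))
    (fun i => mulBy (X i)) pdx pdxi where
  xx i j := LinearMap.ext fun P => mul_left_comm _ _ _
  yx i j := LinearMap.ext fun P => mul_left_comm _ _ _
  qx i j := LinearMap.ext fun P => pdxi_C_mul i _ P
  py i j := LinearMap.ext fun P => pdx_X_mul i j P
  pp i j := LinearMap.ext fun P => pdx_pdx_comm i j P
  qq i j := LinearMap.ext fun P => pdxi_pdxi_comm i j P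
  qp i j := LinearMap.ext fun P => (pdx_pdxi_comm j i P).symm
  px i j := LinearMap.ext fun P => by
    simp only [Module.End.mul_apply, mulBy_apply, LinearMap.add_apply, pdx_C_mul, pd_coord]
    split_ifs <;> simp
  qy i j := LinearMap.ext fun P => by
    simp only [Module.End.mul_apply, mulBy_apply, LinearMap.add_apply, pdxi_X_mul]
    split_ifs <;> simp

theorem mulBy_X_comm {n : ℕ} (i j : Fin n) :
    mulBy (X i : Symb n) * mulBy (X j) = mulBy (X j) * mulBy (X i) :=
  LinearMap.ext fun _ => mul_left_comm _ _ _

theorem mulBy_mul {n : ℕ} (a b : Symb n) : mulBy (a * b) = mulBy a * mulBy b :=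
  LinearMap.ext fun _ => mul_assoc _ _ _

theorem mulBy_zero {n : ℕ} : mulBy (0 : Symb n) = 0 := LinearMap.ext fun _ => zero_mul _

theorem mulBy_one {n : ℕ} : mulBy (1 : Symb n) = 1 := LinearMap.ext fun _ => one_mul _

theorem mulBy_add {n : ℕ} (a b : Symb n) : mulBy (a + b) = mulBy a + mulBy b :=
  LinearMap.ext fun _ => add_mul _ _ _

theorem pd_single {n : ℕ} (i j k : Fin n) (a : SmoothFn n) :
    pd i ((Pi.single j a : Fin n → SmoothFn n) k) = if k = j then pd i a else 0 := by
  rw [Pi.single_apply]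
  split_ifs <;> simp

theorem lieSymb_const {n : ℕ} (i : Fin n) :
    lieSymb 0 (Pi.single i (1 : SmoothFn n)) = pdx i := by
  have h1 : ∀ j : Fin n, mulBy (C ((Pi.single i (1 : SmoothFn n) : Fin n → SmoothFn n) j)) * pdx j =
      if j = i then pdx i else 0 := by
    intro j
    rw [Pi.single_apply]
    split_ifs with hj
    · rw [hj, C_1, mulBy_one, one_mul]
    · rw [C_0, mulBy_zero, zero_mul]
  simp only [lieSymb, h1, pd_single, Derivation.map_one_eq_zero, ite_self, C_0, zero_mul,
    mulBy_zero, Finset.sum_const_zero, sub_zero, smul_zero, add_zero, Finset.sum_ite_eq',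
    Finset.mem_univ, if_true]

theorem lieSymb_lin {n : ℕ} (i j : Fin n) :
    lieSymb 0 (Pi.single j (coord i : SmoothFn n)) =
      mulBy (C (coord i)) * pdx j - mulBy (X j) * pdxi i := by
  have h1 : ∀ k : Fin n, mulBy (C ((Pi.single j (coord i) : Fin n → SmoothFn n) k)) * pdx k =
      if k = j then mulBy (C (coord i)) * pdx j else 0 := by
    intro k
    rw [Pi.single_apply]
    split_ifs with hj
    · rw [hj]
    · rw [C_0, mulBy_zero, zero_mul]
  have h2 : ∀ k l : Fin n, mulBy (C (if k = j then if l = i then (1 : SmoothFn n) else 0 else 0)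
      * X k) * pdxi l = if k = j then if l = i then mulBy (X j) * pdxi i else 0 else 0 := by
    intro k l
    split_ifs with hk hl
    · rw [hk, hl, C_1, one_mul]
    all_goals rw [C_0, zero_mul, mulBy_zero, zero_mul]
  simp only [lieSymb, h1, pd_single, pd_coord, h2, Finset.sum_ite_eq', Finset.mem_univ, if_true,
    Complex.ofReal_zero, zero_smul, add_zero]
  simp

theorem lieSymb_quad {n : ℕ} (i : Fin n) :
    lieSymb 0 (fun j => coord i * coord j : Fin n → SmoothFn n) =
      WeylRel.quad (fun i : Fin n => mulBy (C (coord i))) (fun i => mulBy (X i)) pdx pdxi i := by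
  have h2 : ∀ k l : Fin n, mulBy (C (pd l (coord i * coord k : SmoothFn n)) * X k) * pdxi l =
      (if l = k then mulBy (C (coord i)) * (mulBy (X l) * pdxi l) else 0) +
      if l = i then mulBy (C (coord k)) * (mulBy (X k)) * pdxi i else 0 := by
    intro k l
    rw [Derivation.leibniz, pd_coord, pd_coord, smul_eq_mul, smul_eq_mul, C_add, add_mul,
      mulBy_add, add_mul]
    congr 1
    · split_ifs with hl
      · rw [mul_one, hl, mulBy_mul, mul_assoc]
      · rw [mul_zero, C_0, zero_mul, mulBy_zero, zero_mul]
    · split_ifs with hl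
      · rw [mul_one, hl, mulBy_mul]
      · rw [mul_zero, C_0, zero_mul, mulBy_zero, zero_mul]
  simp only [lieSymb, h2, Complex.ofReal_zero, zero_smul, add_zero,
    Finset.sum_add_distrib, Finset.sum_ite_eq', Finset.mem_univ, if_true]
  simp only [WeylRel.quad, C_mul, mulBy_mul, Finset.mul_sum, Finset.sum_mul, mul_assoc,
    sub_add_eq_sub_sub]

theorem lieDens_const {n : ℕ} (lam : ℝ) (i : Fin n) :
    lieDens lam (Pi.single i (1 : SmoothFn n)) = (pd i).toLinearMap := by
  have h1 : ∀ j : Fin n, LinearMap.mulLeft ℂ ((Pi.single i (1 : SmoothFn n) : Fin n → SmoothFn n) j)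
      * ((pd j).toLinearMap : Op n) = if j = i then ((pd i).toLinearMap : Op n) else 0 := by
    intro j
    rw [Pi.single_apply]
    split_ifs with hj
    · rw [hj, LinearMap.mulLeft_one]; rfl
    · rw [LinearMap.mulLeft_zero_eq_zero, zero_mul]
  simp only [lieDens, h1, pd_single, Derivation.map_one_eq_zero, ite_self, Finset.sum_const_zero,
    LinearMap.mulLeft_zero_eq_zero, smul_zero, add_zero, Finset.sum_ite_eq',
    Finset.mem_univ, if_true]

theorem lieDens_lin {n : ℕ} (lam : ℝ) (i j : Fin n) :
    lieDens lam (Pi.single j (coord i : SmoothFn n)) =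
      LinearMap.mulLeft ℂ (coord i) * ((pd j).toLinearMap : Op n)
        + (if j = i then (lam : ℂ) else 0) • (1 : Op n) := by
  have h1 : ∀ k : Fin n, LinearMap.mulLeft ℂ ((Pi.single j (coord i) : Fin n → SmoothFn n) k)
      * ((pd k).toLinearMap : Op n) =
      if k = j then LinearMap.mulLeft ℂ (coord i) * ((pd j).toLinearMap : Op n) else 0 := by
    intro k
    rw [Pi.single_apply]
    split_ifs with hj
    · rw [hj]
    · rw [LinearMap.mulLeft_zero_eq_zero, zero_mul]
  simp only [lieDens, h1, pd_single, pd_coord, Finset.sum_ite_eq', Finset.mem_univ, if_true]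
  congr 1
  split_ifs with h
  · rw [LinearMap.mulLeft_one]; rfl
  · rw [LinearMap.mulLeft_zero_eq_zero, smul_zero, zero_smul]

theorem lieDens_quad {n : ℕ} (lam : ℝ) (i : Fin n) :
    lieDens lam (fun j => coord i * coord j : Fin n → SmoothFn n) =
      ∑ j, LinearMap.mulLeft ℂ (coord i) * LinearMap.mulLeft ℂ (coord j) *
        ((pd j).toLinearMap : Op n) + ((lam : ℂ) * (n + 1)) • LinearMap.mulLeft ℂ (coord i) := by
  -- The divergence of the quadratic field: n from the terms ∂ⱼxʲ and one more from ∂ᵢxⁱ.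
  have h1 : ∑ j, pd j (coord i * coord j : SmoothFn n) = ((n : ℂ) + 1) • coord i := by
    simp only [Derivation.leibniz, pd_coord, if_true, smul_eq_mul, mul_one, mul_ite, mul_zero,
      Finset.sum_add_distrib, Finset.sum_ite_eq', Finset.mem_univ, Finset.sum_const,
      Finset.card_univ, Fintype.card_fin]
    rw [add_smul, one_smul, Nat.cast_smul_eq_nsmul]
  rw [lieDens, h1, mul_smul]
  congr 1
  · simp only [LinearMap.mulLeft_mul]
    rfl
  · congr 1
    refine LinearMap.ext fun f => ?_
    exact smul_mul_assoc _ _ _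

theorem lieOp_const_fourierLin {n : ℕ} (lam hbar : ℝ) (i : Fin n) (P : Symb n) :
    lieOp lam lam (Pi.single i (1 : SmoothFn n)) (fourierLin n hbar P) =
      fourierLin n hbar (lieSymb 0 (Pi.single i (1 : SmoothFn n)) P) := by
  rw [lieOp, lieDens_const, lieSymb_const, fourierLin_pdx]

/-! ### Lie derivatives of operators computed on symbols -/

section
variable {n : ℕ} {hbar : ℝ}

/-- Moving xⁱ to the right, where it multiplies the coefficients, costs the commutator of
`fourierLin_pdxi`. -/
theorem coord_mul_fourierLin (hbar : ℝ) (i : Fin n) (P : Symb n) :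
    LinearMap.mulLeft ℂ (coord i) * fourierLin n hbar P =
      fourierLin n hbar ((mulBy (C (coord i)) - (-Complex.I * hbar) • pdxi i) P) := by
  rw [LinearMap.sub_apply, LinearMap.smul_apply, map_sub, map_smul, fourierLin_pdxi, mulBy_apply,
    fourierLin_C_mul, sub_sub_cancel]

theorem smul_fourierLin_mul_pd (hbar : ℝ) (i : Fin n) (P : Symb n) :
    (-Complex.I * hbar) • (fourierLin n hbar P * ((pd i).toLinearMap : Op n)) =
      fourierLin n hbar ((mulBy (X i) - (-Complex.I * hbar) • pdx i) P) := by
  rw [LinearMap.sub_apply, LinearMap.smul_apply, map_sub, map_smul, fourierLin_pdx, mulBy_apply,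
    fourierLin_X_mul, smul_sub, sub_sub_cancel]

theorem smul_pd_mul_fourierLin (hbar : ℝ) (i : Fin n) (P : Symb n) :
    (-Complex.I * hbar) • (((pd i).toLinearMap : Op n) * fourierLin n hbar P) =
      fourierLin n hbar (mulBy (X i) P) := by
  rw [mulBy_apply, fourierLin_X_mul]

theorem fourierLin_mul_coord (hbar : ℝ) (i : Fin n) (P : Symb n) :
    fourierLin n hbar P * LinearMap.mulLeft ℂ (coord i) =
      fourierLin n hbar (mulBy (C (coord i)) P) := by
  rw [mulBy_apply, fourierLin_C_mul]

theorem planck_ne_zero (h : hbar ≠ 0) : (-Complex.I * hbar : ℂ) ≠ 0 := by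
  simp [h]

/-- A linear field has constant divergence, so the density weight adds a scalar that drops out of
the commutator, whatever `lam` is. -/
theorem lieOp_lin_fourierLin (h : hbar ≠ 0) (lam : ℝ) (i j : Fin n) (P : Symb n) :
    lieOp lam lam (Pi.single j (coord i : SmoothFn n)) (fourierLin n hbar P) =
      fourierLin n hbar (lieSymb 0 (Pi.single j (coord i : SmoothFn n)) P) := by
  -- Multiplying by c ≠ 0 turns each ∂ⱼ into c∂ⱼ, whose composition on either side has an expression
  -- on symbols.
  refine smul_right_injective _ (planck_ne_zero h) ?_
  have hw := weylRel_symb n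
  have key : (mulBy (C (coord i)) - (-Complex.I * hbar) • pdxi i) * mulBy (X j)
      - (mulBy (X j) - (-Complex.I * hbar) • pdx j) * mulBy (C (coord i)) =
      (-Complex.I * hbar) • (mulBy (C (coord i)) * pdx j - mulBy (X j) * pdxi i) := by
    have h1 := hw.qy i j
    have h2 := hw.px j i
    have h3 := hw.yx j i
    simp only [sub_mul, smul_mul_assoc, h1, h2, h3, eq_comm (a := j)]
    module
  simp only
  rw [lieOp, lieDens_lin, lieSymb_lin, ← map_smul (fourierLin n hbar), ← LinearMap.smul_apply,
    ← key, add_mul, mul_add, smul_mul_assoc, mul_smul_comm, one_mul, mul_one,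
    add_sub_add_right_eq_sub, smul_sub, ← mul_assoc, fourierLin_mul_coord, smul_fourierLin_mul_pd,
    mul_assoc, ← mul_smul_comm, smul_pd_mul_fourierLin, coord_mul_fourierLin, ← map_sub]
  rfl

/-- `quad_star` gives the correction c∂/∂ξᵢ(𝓔 + n), and the half-density term (n+1)xⁱ/2 subtracts
c(n+1)/2 ∂/∂ξᵢ, leaving 𝓔 + (n-1)/2. -/
theorem lieOp_quad_fourierLin (h : hbar ≠ 0) (i : Fin n) (P : Symb n) :
    lieOp (1 / 2) (1 / 2) (fun j => coord i * coord j) (fourierLin n hbar P) =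
      fourierLin n hbar (lieSymb 0 (fun j => coord i * coord j) P + (-Complex.I * hbar) •
        pdxi i (euler n P + (((n : ℂ) - 1) / 2) • P)) := by
  have hs := LinearMap.congr_fun ((weylRel_symb n).quad_star (-Complex.I * hbar) i) P
  rw [← lieSymb_quad, ← euler, LinearMap.sub_apply, LinearMap.sum_apply, LinearMap.sum_apply] at hs
  have hl : ∀ j, (-Complex.I * hbar) • (LinearMap.mulLeft ℂ (coord i) *
      LinearMap.mulLeft ℂ (coord j) * ((pd j).toLinearMap : Op n) * fourierLin n hbar P) =
      fourierLin n hbar (((mulBy (C (coord i)) - (-Complex.I * hbar) • pdxi i) *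
        (mulBy (C (coord j)) - (-Complex.I * hbar) • pdxi j) * mulBy (X j)) P) := by
    intro j
    rw [mul_assoc, mul_assoc, ← mul_smul_comm, ← mul_smul_comm, smul_pd_mul_fourierLin,
      coord_mul_fourierLin, coord_mul_fourierLin]
    rfl
  have hr : ∀ j, (-Complex.I * hbar) • (fourierLin n hbar P * (LinearMap.mulLeft ℂ (coord i) *
      LinearMap.mulLeft ℂ (coord j) * ((pd j).toLinearMap : Op n))) =
      fourierLin n hbar (((mulBy (X j) - (-Complex.I * hbar) • pdx j) *
        mulBy (C (coord j)) * mulBy (C (coord i))) P) := by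
    intro j
    rw [← mul_assoc, ← mul_assoc, fourierLin_mul_coord, fourierLin_mul_coord,
      smul_fourierLin_mul_pd]
    rfl
  have hd : ∀ c : ℂ, c • LinearMap.mulLeft ℂ (coord i) * fourierLin n hbar P
      - fourierLin n hbar P * c • LinearMap.mulLeft ℂ (coord i) =
      fourierLin n hbar (-(c * (-Complex.I * hbar)) • pdxi i P) := by
    intro c
    rw [smul_mul_assoc, mul_smul_comm, neg_smul, map_neg, mul_smul, map_smul, map_smul,
      fourierLin_pdxi, smul_sub, neg_sub]
  refine smul_right_injective _ (planck_ne_zero h) ?_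
  simp only
  rw [lieOp, lieDens_quad, add_mul, mul_add (fourierLin n hbar P), add_sub_add_comm, hd, smul_add,
    smul_sub, Finset.sum_mul, Finset.mul_sum, Finset.smul_sum, Finset.smul_sum,
    Finset.sum_congr rfl fun j _ => hl j, Finset.sum_congr rfl fun j _ => hr j,
    ← map_sum, ← map_sum, ← map_sub, hs, ← map_smul, ← map_add, ← map_smul]
  simp only [LinearMap.smul_apply, LinearMap.add_apply, Module.End.mul_apply,
    map_add, map_smul, Fintype.card_fin, Module.End.natCast_apply, map_nsmul]
  rw [← Nat.cast_smul_eq_nsmul ℂ]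
  push_cast
  module

end

/-! ### Operators that act by a scalar in each degree -/

section
variable {n : ℕ}

/-- The operator that acts by the scalar `f k` on symbols of degree `k`. -/
def degScale (n : ℕ) (f : ℕ → ℂ) : Module.End ℂ (Symb n) :=
  symbLift fun α => f α.degree • (monomial α).restrictScalars ℂ

theorem degScale_monomial (f : ℕ → ℂ) (α : Fin n →₀ ℕ) (a : SmoothFn n) :
    degScale n f (monomial α a) = f α.degree • monomial α a :=
  symbLift_monomial _ _ _

/-- `degScale` as a homomorphism of algebras. -/
def degMul (n : ℕ) : (ℕ → ℂ) →ₐ[ℂ] Module.End ℂ (Symb n) :=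
  AlgHom.ofLinearMap
    { toFun := degScale n
      map_add' := fun f g => symb_linear_ext fun α a => by
        rw [LinearMap.add_apply, degScale_monomial, degScale_monomial, degScale_monomial,
          Pi.add_apply, add_smul]
      map_smul' := fun c f => symb_linear_ext fun α a => by
        rw [RingHom.id_apply, LinearMap.smul_apply, degScale_monomial, degScale_monomial,
          Pi.smul_apply, smul_eq_mul, mul_smul] }
    (symb_linear_ext fun α a => (degScale_monomial 1 α a).trans (one_smul _ _))
    (fun f g => symb_linear_ext fun α a => by
      change degScale n (f * g) (monomial α a) = degScale n f (degScale n g (monomial α a))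
      rw [degScale_monomial, degScale_monomial, map_smul, degScale_monomial, Pi.mul_apply,
        mul_comm, mul_smul])

theorem degMul_monomial (f : ℕ → ℂ) (α : Fin n →₀ ℕ) (a : SmoothFn n) :
    degMul n f (monomial α a) = f α.degree • monomial α a :=
  symbLift_monomial _ _ _

theorem coeff_degMul (f : ℕ → ℂ) (P : Symb n) (β : Fin n →₀ ℕ) :
    (degMul n f P).coeff β = f β.degree • P.coeff β := by
  classical
  induction P using MvPolynomial.induction_on' with
  | monomial α a =>
    rw [degMul_monomial, coeff_smul, coeff_monomial]
    split_ifs with h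
    · rw [h]
    · rw [smul_zero, smul_zero]
  | add p q hp hq => rw [map_add, coeff_add, coeff_add, hp, hq, smul_add]

theorem degMul_of_isHomogeneous (f : ℕ → ℂ) {P : Symb n} {k : ℕ} (hP : P.IsHomogeneous k) :
    degMul n f P = f k • P := by
  ext1 β
  rw [coeff_degMul, coeff_smul]
  by_cases h : β.degree = k
  · rw [h]
  · rw [hP.coeff_eq_zero h, smul_zero, smul_zero]

theorem euler_eq_degMul : euler n = degMul n fun k => (k : ℂ) := by
  refine symb_linear_ext fun α a => ?_
  rw [degMul_monomial, euler, LinearMap.sum_apply, Nat.cast_smul_eq_nsmul,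
    ← (isHomogeneous_monomial a rfl).sum_X_mul_pderiv]
  rfl

theorem isHomogeneous_of_euler {P : Symb n} {k : ℕ} (h : euler n P = (k : ℂ) • P) :
    P.IsHomogeneous k := by
  intro β hβ
  rw [euler_eq_degMul] at h
  have := congrArg (coeff β) h
  rw [coeff_degMul, coeff_smul] at this
  have h2 := smul_left_injective ℂ hβ this
  have h3 : β.degree = k := by exact_mod_cast h2
  rw [← h3, Finsupp.degree_eq_weight_one]
  rfl

theorem eq_zero_of_euler {P : Symb n} {c : ℂ} (h : euler n P = c • P) (hc : ∀ k : ℕ, (k : ℂ) ≠ c) :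
    P = 0 := by
  ext1 β
  rw [euler_eq_degMul] at h
  have := congrArg (coeff β) h
  rw [coeff_degMul, coeff_smul] at this
  by_contra hβ
  exact hc _ (smul_left_injective ℂ hβ this)

theorem euler_of_isHomogeneous {P : Symb n} {k : ℕ} (hP : P.IsHomogeneous k) :
    euler n P = (k : ℂ) • P := by
  rw [euler_eq_degMul, degMul_of_isHomogeneous _ hP]

theorem symb_linear_ext_homogeneous {V : Type*} [AddCommGroup V] [Module ℂ V]
    {L₁ L₂ : Symb n →ₗ[ℂ] V} (h : ∀ k P, P.IsHomogeneous k → L₁ P = L₂ P) : L₁ = L₂ :=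
  symb_linear_ext fun α a => h α.degree _ (isHomogeneous_monomial a rfl)

theorem isUnit_degMul {f : ℕ → ℂ} (h : ∀ k, f k ≠ 0) : IsUnit (degMul n f) :=
  (Pi.isUnit_iff.2 fun k => (h k).isUnit).map (degMul n)

theorem inverse_degMul {f : ℕ → ℂ} (h : ∀ k, f k ≠ 0) :
    Ring.inverse (degMul n f) = degMul n f⁻¹ := by
  have h1 : f * f⁻¹ = 1 := funext fun k => mul_inv_cancel₀ (h k)
  refine Ring.inverse_unit ⟨degMul n f, degMul n f⁻¹, ?_, ?_⟩
  · rw [← map_mul, h1, map_one]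
  · rw [← map_mul, mul_comm, h1, map_one]

/-- Polynomial calculus commutes with algebra homomorphisms, so identities between polynomials in 𝓔
become scalar identities in each degree. -/
theorem poch_degMul (f : ℕ → ℂ) (m : ℕ) :
    poch (degMul n f) m = degMul n fun k => (ascPochhammer ℂ m).eval (f k) := by
  rw [poch, Polynomial.aeval_algHom_apply]
  congr 1
  funext k
  have := Polynomial.aeval_algHom_apply (Pi.evalAlgHom ℂ (fun _ : ℕ => ℂ) k) f (ascPochhammer ℂ m)
  rw [Pi.evalAlgHom_apply, Pi.evalAlgHom_apply, Polynomial.coe_aeval_eq_eval] at this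
  exact this.symm

theorem eulerShift_eq_degMul : eulerShift n = degMul n fun k => (k : ℂ) + n / 2 := by
  rw [eulerShift, euler_eq_degMul, ← map_one (degMul n), ← map_smul, ← map_add]
  congr 1
  funext k
  simp

/-! ### The divergence and the degree -/

theorem euler_divg (P : Symb n) : euler n (divg n P) = divg n (euler n P) - divg n P :=
  (sub_eq_of_eq_add (LinearMap.congr_fun (weylRel_symb n).div_eulerMom P)).symm

theorem euler_divg_pow {P : Symb n} {k : ℕ} (hP : P.IsHomogeneous k) (m : ℕ) :
    euler n ((divg n ^ m) P) = ((k : ℂ) - m) • (divg n ^ m) P := by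
  induction m with
  | zero => simpa using euler_of_isHomogeneous hP
  | succ m ih =>
    rw [pow_succ', Module.End.mul_apply, euler_divg, ih, map_smul]
    push_cast
    module

theorem divg_pow_isHomogeneous {P : Symb n} {k m : ℕ} (hP : P.IsHomogeneous (k + m)) :
    ((divg n ^ m) P).IsHomogeneous k := by
  refine isHomogeneous_of_euler ?_
  rw [euler_divg_pow hP]
  push_cast
  rw [add_sub_cancel_right]

/-- Otherwise 𝓔 would have the negative eigenvalue k - m. -/
theorem divg_pow_eq_zero {P : Symb n} {k m : ℕ} (hP : P.IsHomogeneous k) (hm : k < m) :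
    (divg n ^ m) P = 0 := by
  refine eq_zero_of_euler (euler_divg_pow hP m) fun j hj => ?_
  have : ((j + m : ℕ) : ℂ) = k := by push_cast; rw [hj]; ring
  have := Nat.cast_injective (R := ℂ) this
  omega

theorem exists_divg_pow_eq_zero (P : Symb n) : ∃ N : ℕ, ∀ m, N ≤ m → (divg n ^ m) P = 0 := by
  refine ⟨P.totalDegree + 1, fun m hm => ?_⟩
  rw [← sum_homogeneousComponent P, map_sum]
  refine Finset.sum_eq_zero fun k hk => ?_
  rw [Finset.mem_range] at hk
  exact divg_pow_eq_zero (homogeneousComponent_isHomogeneous k P) (by omega)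

theorem varZ_pow (hbar : ℝ) (m : ℕ) :
    varZ n hbar ^ m = (Complex.I * hbar / 4) ^ m • divg n ^ m := smul_pow _ _ _

theorem exists_varZ_pow_eq_zero (hbar : ℝ) (P : Symb n) :
    ∃ N : ℕ, ∀ m, N ≤ m → (varZ n hbar ^ m) P = 0 := by
  obtain ⟨N, hN⟩ := exists_divg_pow_eq_zero P
  exact ⟨N, fun m hm => by rw [varZ_pow, LinearMap.smul_apply, hN m hm, smul_zero]⟩

/-! ### The hypergeometric series -/

theorem hyp_eq_sum {as bs : List (Module.End ℂ (Symb n))} {Z : Module.End ℂ (Symb n)} {P : Symb n}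
    {N : ℕ} (h : ∀ m, N ≤ m → (Z ^ m) P = 0) :
    hyp as bs Z P = ∑ m ∈ Finset.range N, hypTerm as bs Z m P := by
  refine finsum_eq_sum_of_support_subset _ fun m hm => ?_
  rw [Finset.coe_range, Set.mem_Iio]
  by_contra hN
  refine hm ?_
  change hypTerm as bs Z m P = 0
  rw [hypTerm, LinearMap.smul_apply, Module.End.mul_apply, h m (not_lt.1 hN), map_zero, smul_zero]

/-- The hypergeometric series as a linear map, for a locally nilpotent variable. -/
def hypLin (as bs : List (Module.End ℂ (Symb n))) (Z : Module.End ℂ (Symb n))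
    (hZ : ∀ P : Symb n, ∃ N : ℕ, ∀ m, N ≤ m → (Z ^ m) P = 0) : Module.End ℂ (Symb n) where
  toFun := hyp as bs Z
  map_add' P R := by
    obtain ⟨N, hN⟩ := hZ P
    obtain ⟨M, hM⟩ := hZ R
    have hN' : ∀ m, max N M ≤ m → (Z ^ m) P = 0 := fun m hm => hN m (le_of_max_le_left hm)
    have hM' : ∀ m, max N M ≤ m → (Z ^ m) R = 0 := fun m hm => hM m (le_of_max_le_right hm)
    rw [hyp_eq_sum hN', hyp_eq_sum hM', hyp_eq_sum (P := P + R) (N := max N M) fun m hm => by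
      rw [map_add, hN' m hm, hM' m hm, add_zero], ← Finset.sum_add_distrib]
    simp only [map_add]
  map_smul' c P := by
    obtain ⟨N, hN⟩ := hZ P
    rw [hyp_eq_sum hN, hyp_eq_sum (P := c • P) (N := N) fun m hm => by
      rw [map_smul, hN m hm, smul_zero], RingHom.id_apply, Finset.smul_sum]
    simp only [map_smul]

theorem ascPochhammer_eval_ne_zero {r : ℝ} (hr : 0 < r) (m : ℕ) :
    (ascPochhammer ℂ m).eval (r : ℂ) ≠ 0 := by
  have : (ascPochhammer ℂ m).eval (r : ℂ) = (((ascPochhammer ℝ m).eval r : ℝ) : ℂ) := by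
    rw [← ascPochhammer_map Complex.ofRealHom, Polynomial.eval_map]
    exact Polynomial.eval₂_at_apply Complex.ofRealHom r
  rw [this]
  exact_mod_cast (ascPochhammer_pos m r hr).ne'

/-- Used with c = 0 and c = 1 for the two denominators; n ≥ 1 keeps the argument positive even in
degree zero. -/
theorem ascPochhammer_eval_degree_ne_zero (hn : 1 ≤ n) {c : ℝ} (hc : 0 ≤ c) (m k : ℕ) :
    (ascPochhammer ℂ m).eval ((k : ℂ) + (n + c) / 2) ≠ 0 := by
  have hn' : (1 : ℝ) ≤ n := by exact_mod_cast hn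
  have := ascPochhammer_eval_ne_zero (r := (k : ℝ) + (n + c) / 2) (by positivity) m
  push_cast at this
  exact this

theorem isUnit_poch_eulerShift (hn : 1 ≤ n) (m : ℕ) : IsUnit (poch (eulerShift n) m) := by
  rw [eulerShift_eq_degMul, poch_degMul]
  refine isUnit_degMul fun k => ?_
  simpa using ascPochhammer_eval_degree_ne_zero hn le_rfl m k

theorem paramsA_half : paramsA n (1 / 2) (1 / 2) =
    [degMul n fun k => (k : ℂ) + (n + 1) / 2, degMul n fun k => 2 * (k : ℂ) + n] := by
  rw [paramsA, euler_eq_degMul, ← map_one (degMul n), ← map_smul, ← map_smul, ← map_smul,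
    ← map_add, ← map_add]
  congr 2
  · congr 1
    funext k
    simp
    ring
  · congr 2
    funext k
    simp

theorem paramsB_half : paramsB n (1 / 2) (1 / 2) =
    [degMul n fun k => (k : ℂ) + n / 2, degMul n fun k => (k : ℂ) + (n + 1) / 2] := by
  rw [paramsB, euler_eq_degMul, ← map_one (degMul n), ← map_smul, ← map_smul, ← map_add, ← map_add]
  congr 2
  · congr 1
    funext k
    simp
    ring
  · congr 2
    funext k
    simp

theorem isUnit_poch_paramsB (hn : 1 ≤ n) (m : ℕ) (b : Module.End ℂ (Symb n))
    (hb : b ∈ paramsB n (1 / 2) (1 / 2)) : IsUnit (poch b m) := by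
  rw [paramsB_half, List.mem_cons, List.mem_singleton] at hb
  rcases hb with rfl | rfl
  · rw [← eulerShift_eq_degMul]
    exact isUnit_poch_eulerShift hn m
  · rw [poch_degMul]
    refine isUnit_degMul fun k => ?_
    simpa using ascPochhammer_eval_degree_ne_zero hn zero_le_one m k

theorem hypTerm_confluent (hn : 1 ≤ n) (Z : Module.End ℂ (Symb n)) (m : ℕ) :
    hypTerm [(2 : ℂ) • eulerShift n] [eulerShift n] Z m = degMul n (fun k =>
      (m.factorial : ℂ)⁻¹ * ((ascPochhammer ℂ m).eval (2 * ((k : ℂ) + n / 2)) *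
        ((ascPochhammer ℂ m).eval ((k : ℂ) + n / 2))⁻¹)) * Z ^ m := by
  have h0 : ∀ k : ℕ, (ascPochhammer ℂ m).eval ((k : ℂ) + n / 2) ≠ 0 := fun k => by
    simpa using ascPochhammer_eval_degree_ne_zero hn le_rfl m k
  simp only [hypTerm, List.map_cons, List.map_nil, List.prod_cons, List.prod_nil, mul_one]
  rw [eulerShift_eq_degMul, ← map_smul, poch_degMul, poch_degMul, inverse_degMul h0, ← map_mul,
    ← smul_mul_assoc, ← map_smul]
  rfl

/-- All parameters are functions of 𝓔 and commute. The factor (𝓔 + (n+1)/2)_m occurs above and below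
and cancels, and 2𝓔 + n = 2E. -/
theorem hypTerm_params_half (hn : 1 ≤ n) (Z : Module.End ℂ (Symb n)) (m : ℕ) :
    hypTerm (paramsA n (1 / 2) (1 / 2)) (paramsB n (1 / 2) (1 / 2)) Z m =
      hypTerm [(2 : ℂ) • eulerShift n] [eulerShift n] Z m := by
  have h0 : ∀ k : ℕ, (ascPochhammer ℂ m).eval ((k : ℂ) + n / 2) ≠ 0 := fun k => by
    simpa using ascPochhammer_eval_degree_ne_zero hn le_rfl m k
  have h1 : ∀ k : ℕ, (ascPochhammer ℂ m).eval ((k : ℂ) + (n + 1) / 2) ≠ 0 := fun k => by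
    simpa using ascPochhammer_eval_degree_ne_zero hn zero_le_one m k
  rw [hypTerm_confluent hn, paramsA_half, paramsB_half]
  simp only [hypTerm, List.map_cons, List.map_nil, List.prod_cons, List.prod_nil, mul_one,
    poch_degMul, ← map_mul]
  rw [inverse_degMul (f := (fun k : ℕ => (ascPochhammer ℂ m).eval ((k : ℂ) + n / 2)) *
    fun k : ℕ => (ascPochhammer ℂ m).eval ((k : ℂ) + (n + 1) / 2))
    fun k => mul_ne_zero (h0 k) (h1 k), ← map_mul, ← smul_mul_assoc, ← map_smul]
  congr 2
  funext k
  have h0 := h0 k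
  have h1 := h1 k
  simp only [Pi.smul_apply, Pi.mul_apply, Pi.inv_apply, smul_eq_mul, mul_inv]
  rw [show 2 * ((k : ℂ) + n / 2) = 2 * k + n by ring]
  generalize (ascPochhammer ℂ m).eval ((k : ℂ) + n / 2) = u at *
  generalize (ascPochhammer ℂ m).eval ((k : ℂ) + (n + 1) / 2) = v at *
  field_simp

theorem hyp_params_half (hn : 1 ≤ n) (Z : Module.End ℂ (Symb n)) (P : Symb n) :
    hyp (paramsA n (1 / 2) (1 / 2)) (paramsB n (1 / 2) (1 / 2)) Z P =
      hyp [(2 : ℂ) • eulerShift n] [eulerShift n] Z P := by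
  simp only [hyp, hypTerm_params_half hn]

/-- The coefficients of the confluent series in degree `k` satisfy the recursion of
`quantCoeff`. -/
theorem quantCoeff_eq (hn : 1 ≤ n) (k : ℕ) : ∀ m ≤ k, (quantCoeff n (1 / 2) 0 k m : ℂ) =
    (m.factorial : ℂ)⁻¹ * ((ascPochhammer ℂ m).eval (2 * (((k - m : ℕ) : ℂ) + n / 2)) *
        ((ascPochhammer ℂ m).eval (((k - m : ℕ) : ℂ) + n / 2))⁻¹) * (1 / 4) ^ m
  | 0, _ => by simp [quantCoeff]
  | m + 1, hm => by
    -- Here l = k - (m+1) is the degree seen by the coefficient of Z^(m+1); the previous coefficient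
    -- sees l + 1.
    obtain ⟨l, rfl⟩ := Nat.exists_eq_add_of_le hm
    have h0 : ∀ m k : ℕ, (ascPochhammer ℂ m).eval ((k : ℂ) + n / 2) ≠ 0 := fun m k => by
      simpa using ascPochhammer_eval_degree_ne_zero hn le_rfl m k
    have ih := quantCoeff_eq hn (m + 1 + l) m (by omega)
    rw [show m + 1 + l - m = l + 1 by omega] at ih
    rw [show m + 1 + l - (m + 1) = l by omega, quantCoeff, Complex.ofReal_mul, ih]
    have e1 : (ascPochhammer ℂ (m + 1)).eval ((l : ℂ) + n / 2) =
        ((l : ℂ) + n / 2) * (ascPochhammer ℂ m).eval (((l + 1 : ℕ) : ℂ) + n / 2) := by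
      rw [ascPochhammer_succ_left]
      simp [add_right_comm]
    -- Raising the degree by one shifts 2E by two. With w = l + n/2, both sides equal (2w)_(m+2),
    -- split off at its last factor or at its first two.
    have e2 : (ascPochhammer ℂ (m + 1)).eval (2 * ((l : ℂ) + n / 2)) * (2 * l + n + m + 1) =
        (2 * l + n) * (2 * l + n + 1) *
          (ascPochhammer ℂ m).eval (2 * (((l + 1 : ℕ) : ℂ) + n / 2)) := by
      have a1 := ascPochhammer_succ_eval (S := ℂ) (m + 1) (2 * ((l : ℂ) + n / 2))
      rw [ascPochhammer_succ_left, ascPochhammer_succ_left] at a1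
      simp only [Polynomial.mul_comp, Polynomial.X_comp, Polynomial.eval_mul, Polynomial.eval_X,
        Polynomial.eval_comp, Polynomial.eval_add, Polynomial.eval_one] at a1
      rw [ascPochhammer_succ_left]
      simp only [Polynomial.eval_mul, Polynomial.eval_X,
        Polynomial.eval_comp, Polynomial.eval_add, Polynomial.eval_one]
      rw [show 2 * (((l + 1 : ℕ) : ℂ) + n / 2) = 2 * ((l : ℂ) + n / 2) + 1 + 1 by push_cast; ring]
      push_cast at a1
      linear_combination -a1
    have b1 : ((l : ℂ) + n / 2) ≠ 0 := by simpa using h0 1 l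
    have b2 : (2 * (l : ℂ) + n + m + 1) ≠ 0 := by exact_mod_cast Nat.succ_ne_zero (2 * l + n + m)
    have b3 : ((m : ℂ) + 1) ≠ 0 := by exact_mod_cast Nat.succ_ne_zero m
    have b4 := h0 m (l + 1)
    have b5 : (m.factorial : ℂ) ≠ 0 := by exact_mod_cast m.factorial_ne_zero
    rw [e1, eq_div_of_mul_eq b2 e2, Nat.factorial_succ]
    generalize (ascPochhammer ℂ m).eval (((l + 1 : ℕ) : ℂ) + n / 2) = u at *
    generalize (ascPochhammer ℂ m).eval (2 * (((l + 1 : ℕ) : ℂ) + n / 2)) = v at *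
    push_cast
    rw [show (2 * ((m : ℂ) + 1 + l) - m - 2 + (n + 1) * (1 - 0)) = 2 * l + n + m + 1 by ring,
      show ((m : ℂ) + 1 + l - m - 1 + (n + 1) * (1 / 2)) = (2 * l + n + 1) / 2 by ring,
      show (2 * (l : ℂ) + n) = 2 * (l + n / 2) by ring]
    rw [show (2 * (l : ℂ) + n) = 2 * (l + n / 2) by ring] at b2
    generalize ((l : ℂ) + n / 2) = w at *
    field_simp
    ring

theorem hyp_confluent_of_isHomogeneous (hn : 1 ≤ n) (hbar : ℝ) {k : ℕ} {P : Symb n}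
    (hP : P.IsHomogeneous k) :
    hyp [(2 : ℂ) • eulerShift n] [eulerShift n] (varZ n hbar) P =
      ∑ m ∈ Finset.range (k + 1),
        (quantCoeff n (1 / 2) 0 k m : ℂ) • (((Complex.I * hbar) • divg n) ^ m) P := by
  rw [hyp_eq_sum (N := k + 1) fun m hm => by
    rw [varZ_pow, LinearMap.smul_apply, divg_pow_eq_zero hP hm, smul_zero]]
  refine Finset.sum_congr rfl fun m hm => ?_
  have hmk : m ≤ k := Nat.lt_succ_iff.1 (Finset.mem_range.1 hm)
  have hh : ((divg n ^ m) P).IsHomogeneous (k - m) :=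
    divg_pow_isHomogeneous (by rwa [Nat.sub_add_cancel hmk])
  rw [hypTerm_confluent hn, Module.End.mul_apply, varZ_pow, smul_pow, LinearMap.smul_apply,
    LinearMap.smul_apply, map_smul, degMul_of_isHomogeneous _ hh, quantCoeff_eq hn k m hmk,
    smul_smul, smul_smul, div_eq_mul_one_div, mul_pow]
  congr 1
  ring

end

/-! ### Symbols and operators of bounded order -/

section
variable {n : ℕ}

/-- The symbols of degree less than `k`. -/
def lowSymb (n k : ℕ) : Submodule ℂ (Symb n) where
  carrier := {R | ∀ β : Fin n →₀ ℕ, k ≤ β.degree → R.coeff β = 0}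
  zero_mem' := fun _ _ => coeff_zero _
  add_mem' := fun hP hR β hβ => by rw [coeff_add, hP β hβ, hR β hβ, add_zero]
  smul_mem' := fun c P hP β hβ => by rw [coeff_smul, hP β hβ, smul_zero]

theorem mem_lowSymb {k : ℕ} {R : Symb n} :
    R ∈ lowSymb n k ↔ ∀ α ∈ R.support, α.degree < k := by
  refine forall_congr' fun β => ?_
  rw [mem_support_iff, ← not_le]
  tauto

theorem lowSymb_mono {j k : ℕ} (h : j ≤ k) : lowSymb n j ≤ lowSymb n k :=
  fun _ hR β hβ => hR β (h.trans hβ)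

theorem mem_lowSymb_totalDegree (P : Symb n) : P ∈ lowSymb n (P.totalDegree + 1) :=
  mem_lowSymb.2 fun _ hα => Nat.lt_succ_of_le (le_totalDegree hα)

theorem monomial_mem_lowSymb {k : ℕ} {α : Fin n →₀ ℕ} (h : α.degree < k) (a : SmoothFn n) :
    monomial α a ∈ lowSymb n k := fun β hβ => by
  classical
  rw [coeff_monomial, if_neg]
  rintro rfl
  omega

theorem map_mem_of_monomial {V : Type*} [AddCommGroup V] [Module ℂ V] (L : Symb n →ₗ[ℂ] V)
    (S : Submodule ℂ V) {P : Symb n} (h : ∀ α ∈ P.support, ∀ a, L (monomial α a) ∈ S) :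
    L P ∈ S := by
  rw [P.as_sum, map_sum]
  exact S.sum_mem fun α hα => h α hα _

theorem X_mul_mem_lowSymb {k : ℕ} (i : Fin n) {R : Symb n} (hR : R ∈ lowSymb n k) :
    X i * R ∈ lowSymb n (k + 1) := by
  refine map_mem_of_monomial (mulBy (X i)) _ fun α hα a => ?_
  rw [mulBy_apply, X_mul_monomial]
  refine monomial_mem_lowSymb ?_ a
  rw [map_add, Finsupp.degree_single]
  have := mem_lowSymb.1 hR α hα
  omega

theorem pdx_mem_lowSymb {k : ℕ} (i : Fin n) {R : Symb n} (hR : R ∈ lowSymb n k) :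
    pdx i R ∈ lowSymb n k := fun β hβ => by
  rw [coeff_pdx, hR β hβ, map_zero]

theorem isHomogeneous_mem_lowSymb {k j : ℕ} {P : Symb n} (hP : P.IsHomogeneous j) (hj : j < k) :
    P ∈ lowSymb n k := fun β hβ => hP.coeff_eq_zero (by omega)

theorem divg_mem_lowSymb {k : ℕ} {R : Symb n} (hR : R ∈ lowSymb n (k + 1)) :
    divg n R ∈ lowSymb n k := by
  refine map_mem_of_monomial _ _ fun α hα a => ?_
  have hd := mem_lowSymb.1 hR α hα
  have hm : (monomial α a : Symb n).IsHomogeneous α.degree := isHomogeneous_monomial a rfl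
  rw [← pow_one (divg n)]
  by_cases h : α.degree = 0
  · rw [divg_pow_eq_zero hm (by omega)]
    exact Submodule.zero_mem _
  · exact isHomogeneous_mem_lowSymb (k := k) (j := α.degree - 1)
      (divg_pow_isHomogeneous (by rwa [Nat.sub_add_cancel (by omega)])) (by omega)

/-- Moving derivatives to the right of the coefficients changes an operator only in lower order. One
ξᵢ is peeled off at each induction step, and the Leibniz rule supplies the remainder. -/
theorem fourierLin_monomial_sub_mem (hbar : ℝ) (k : ℕ) : ∀ (α : Fin n →₀ ℕ) (_ : α.degree = k)
    (a : SmoothFn n), fourierLin n hbar (monomial α a) -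
      (-Complex.I * hbar) ^ k • coeffLin n (monomial α a) ∈ (lowSymb n k).map (coeffLin n) := by
  induction k with
  | zero =>
    intro α hα a
    rw [(Finsupp.degree_eq_zero_iff α).1 hα, ← C_apply, fourierLin_C, coeffLin_C, pow_zero,
      one_smul, sub_self]
    exact Submodule.zero_mem _
  | succ k ih =>
    intro α hα a
    have h0 : α ≠ 0 := by
      rintro rfl
      simp at hα
    obtain ⟨i, hi⟩ := Finsupp.support_nonempty_iff.2 h0
    have hle : Finsupp.single i 1 ≤ α :=
      Finsupp.single_le_iff.2 (Nat.one_le_iff_ne_zero.2 (Finsupp.mem_support_iff.1 hi))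
    obtain ⟨β, rfl⟩ := exists_add_of_le hle
    rw [map_add, Finsupp.degree_single] at hα
    obtain ⟨R, hR, hRe⟩ := ih β (by omega) a
    rw [eq_sub_iff_add_eq'] at hRe
    rw [← X_mul_monomial, fourierLin_X_mul, ← hRe, mul_add, mul_smul_comm, pd_mul_coeffLin,
      pd_mul_coeffLin]
    refine ⟨(-Complex.I * hbar) ^ (k + 1) • pdx i (monomial β a)
      + (-Complex.I * hbar) • (X i * R + pdx i R), ?_, ?_⟩
    · refine add_mem (Submodule.smul_mem _ _ (pdx_mem_lowSymb i (monomial_mem_lowSymb ?_ a)))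
        (Submodule.smul_mem _ _ (add_mem (X_mul_mem_lowSymb i hR)
          (lowSymb_mono (Nat.le_succ k) (pdx_mem_lowSymb i hR))))
      omega
    · simp only [map_add, map_smul]
      module

theorem fourierLin_sub_mem (hbar : ℝ) {k : ℕ} {P : Symb n} (hP : P.IsHomogeneous k) :
    fourierLin n hbar P - (-Complex.I * hbar) ^ k • coeffLin n P ∈
      (lowSymb n k).map (coeffLin n) := by
  refine map_mem_of_monomial (fourierLin n hbar - (-Complex.I * hbar) ^ k • coeffLin n) _
    fun α hα a => fourierLin_monomial_sub_mem hbar k α ?_ a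
  by_contra h
  exact mem_support_iff.1 hα (hP.coeff_eq_zero h)

theorem fourierLin_mem (hbar : ℝ) {k : ℕ} {P : Symb n} (hP : P ∈ lowSymb n k) :
    fourierLin n hbar P ∈ (lowSymb n k).map (coeffLin n) := by
  refine map_mem_of_monomial _ _ fun α hα a => ?_
  have hd := mem_lowSymb.1 hP α hα
  rw [← sub_add_cancel (fourierLin n hbar (monomial α a))
    ((-Complex.I * hbar) ^ α.degree • coeffLin n (monomial α a))]
  exact add_mem (Submodule.map_mono (lowSymb_mono hd.le)
    (fourierLin_monomial_sub_mem hbar _ α rfl a))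
    (Submodule.smul_mem _ _ (Submodule.mem_map_of_mem (monomial_mem_lowSymb hd a)))

/-- The passage between the two orderings is triangular with diagonal entries c^d, invertible since
ħ ≠ 0; strong induction on the order inverts it. -/
theorem map_coeffLin_le {hbar : ℝ} (h : hbar ≠ 0) (k : ℕ) :
    (lowSymb n k).map (coeffLin n) ≤ (lowSymb n k).map (fourierLin n hbar) := by
  induction k using Nat.strong_induction_on with
  | _ k ih =>
  rintro _ ⟨P, hP, rfl⟩
  refine map_mem_of_monomial _ _ fun α hα a => ?_
  have hd := mem_lowSymb.1 hP α hα
  have hs : (-Complex.I * hbar) ^ α.degree • coeffLin n (monomial α a) ∈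
      (lowSymb n k).map (fourierLin n hbar) := by
    rw [← sub_sub_cancel (fourierLin n hbar (monomial α a))
      ((-Complex.I * hbar) ^ α.degree • coeffLin n (monomial α a))]
    exact sub_mem (Submodule.mem_map_of_mem (monomial_mem_lowSymb hd a))
      (Submodule.map_mono (lowSymb_mono hd.le)
        (ih _ hd (fourierLin_monomial_sub_mem hbar _ α rfl a)))
  exact (Submodule.smul_mem_iff _ (pow_ne_zero _ (planck_ne_zero h))).1 hs

/-- If P gives the zero operator, so do its derivatives ∂P/∂ξᵢ, by commuting with xⁱ. By induction
on the degree they vanish, so P is a function of x, and multiplication by it is zero only if it is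
zero. -/
theorem fourierLin_injective {hbar : ℝ} (h : hbar ≠ 0) :
    Function.Injective (fourierLin n hbar) := by
  have key : ∀ k, ∀ P ∈ lowSymb n k, fourierLin n hbar P = 0 → P = 0 := by
    intro k
    induction k with
    | zero => exact fun P hP _ => MvPolynomial.ext _ _ fun β => hP β (Nat.zero_le _)
    | succ k ih =>
      intro P hP h0
      have hq : ∀ i, pdxi i P = 0 := by
        intro i
        refine ih _ ?_ ?_
        · refine map_mem_of_monomial _ _ fun α hα a => ?_
          have hd := mem_lowSymb.1 hP α hα
          rw [pdxi_apply, pderiv_monomial]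
          by_cases hα : α i = 0
          · rw [hα, Nat.cast_zero, mul_zero, monomial_zero]
            exact Submodule.zero_mem _
          · refine monomial_mem_lowSymb ?_ _
            have hle : Finsupp.single i 1 ≤ α :=
              Finsupp.single_le_iff.2 (Nat.one_le_iff_ne_zero.2 hα)
            obtain ⟨β, rfl⟩ := exists_add_of_le hle
            rw [add_tsub_cancel_left]
            rw [map_add, Finsupp.degree_single] at hd
            omega
        · have := fourierLin_pdxi hbar i P
          rw [h0, zero_mul, mul_zero, sub_zero] at this
          exact (smul_eq_zero_iff_right (planck_ne_zero h)).1 this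
      have he : euler n P = ((0 : ℕ) : ℂ) • P := by
        rw [euler, LinearMap.sum_apply, Nat.cast_zero, zero_smul]
        exact Finset.sum_eq_zero fun i _ => by rw [Module.End.mul_apply, hq, map_zero]
      obtain ⟨a, rfl⟩ : ∃ a, P = C a :=
        ⟨_, totalDegree_eq_zero_iff_eq_C.1 (Nat.le_zero.1
          (isHomogeneous_of_euler he).totalDegree_le)⟩
      rw [fourierLin_C, LinearMap.mulLeft_eq_zero_iff] at h0
      rw [h0, C_0]
  refine (injective_iff_map_eq_zero _).2 fun P hP => key _ P (mem_lowSymb_totalDegree P) hP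

theorem fourierLin_mem_diffOp (hbar : ℝ) (P : Symb n) : fourierLin n hbar P ∈ DiffOp n := by
  obtain ⟨R, -, hR⟩ := fourierLin_mem hbar (mem_lowSymb_totalDegree P)
  exact ⟨R, hR.symm⟩

end

/-! ### The projective action and the degree -/

namespace WeylRel

variable {ι A : Type*} [DecidableEq ι] [Fintype ι] [Ring A] {x y p q : ι → A}

/-- The divergence contracts ∂/∂x with ∂/∂ξ, and this contraction is invariant under linear changes
of coordinates. -/
theorem commute_div_lin (h : WeylRel x y p q) (i j : ι) :
    Commute (∑ l, p l * q l) (x i * p j - y j * q i) := by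
  have h1 := h.div_x i
  have h2 := h.div_p j
  have h3 := h.div_y j
  have h4 := h.div_q i
  have h5 := h.qp i j
  generalize (∑ j, p j * q j) = D at *
  rw [commute_iff_eq, mul_sub, sub_mul, ← mul_assoc, h1, add_mul, mul_assoc (x i) D, h2,
    ← mul_assoc D, h3, add_mul, mul_assoc (y j) D, h4, h5]
  noncomm_ring

theorem commute_eulerMom_lin (h : WeylRel x y p q) (hyy : ∀ i j, y i * y j = y j * y i) (i j : ι) :
    Commute (∑ l, y l * q l) (x i * p j - y j * q i) := by
  have h1 := h.eulerMom_x i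
  have h2 := h.eulerMom_p j
  have h3 := h.eulerMom_y hyy j
  have h4 := h.swap_mom i
  generalize (∑ j, y j * q j) = D at *
  rw [commute_iff_eq, mul_sub, sub_mul, ← mul_assoc, h1, mul_assoc (x i) D, h2,
    ← mul_assoc D, h3, add_mul, mul_assoc (y j) (q i), h4]
  noncomm_ring

theorem commute_eulerMom_quad (h : WeylRel x y p q) (hyy : ∀ i j, y i * y j = y j * y i) (i : ι) :
    Commute (∑ l, y l * q l) (quad x y p q i) := by
  have h0 : (∑ j, y j * q j) * (∑ j, x j * p j) = (∑ j, x j * p j) * ∑ j, y j * q j := by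
    rw [Finset.mul_sum _ _ (∑ j, y j * q j), Finset.sum_mul]
    refine Finset.sum_congr rfl fun i _ => ?_
    rw [← mul_assoc, h.eulerMom_x, mul_assoc, h.eulerMom_p, mul_assoc]
  have h1 := h.eulerMom_x i
  have h3 : (∑ j, y j * q j) * (∑ j, x j * y j) =
      (∑ j, x j * y j) * (∑ j, y j * q j) + ∑ j, x j * y j := by
    rw [Finset.mul_sum _ _ (∑ j, y j * q j), Finset.sum_mul, ← Finset.sum_add_distrib]
    refine Finset.sum_congr rfl fun i _ => ?_
    rw [← mul_assoc, h.eulerMom_x, mul_assoc, h.eulerMom_y hyy, mul_add, mul_assoc]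
  have h4 := h.swap_mom i
  unfold quad
  generalize (∑ j, y j * q j) = e at *
  generalize (∑ j, x j * p j) = E at *
  generalize (∑ j, x j * y j) = S at *
  rw [commute_iff_eq, mul_sub, mul_sub, sub_mul, sub_mul, ← mul_assoc, h1, mul_assoc (x i) e E,
    h0, ← mul_assoc e S, h3, add_mul, mul_assoc S (q i), h4, ← mul_assoc e (x i) e, h1]
  noncomm_ring

end WeylRel

section
variable {n : ℕ}

theorem isHomogeneous_of_commute {L : Module.End ℂ (Symb n)} (hL : Commute (euler n) L) {k : ℕ}
    {P : Symb n} (hP : P.IsHomogeneous k) : (L P).IsHomogeneous k := by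
  refine isHomogeneous_of_euler ?_
  rw [← Module.End.mul_apply, hL.eq, Module.End.mul_apply, euler_of_isHomogeneous hP, map_smul]

theorem slFields_cases {X : Fin n → SmoothFn n} (hX : X ∈ slFields n) :
    (∃ i : Fin n, X = Pi.single i 1) ∨ (∃ i j : Fin n, X = Pi.single j (coord i)) ∨
      ∃ i : Fin n, X = fun j => coord i * coord j := by
  rcases hX with (⟨i, rfl⟩ | ⟨⟨i, j⟩, rfl⟩) | ⟨i, rfl⟩
  · exact Or.inl ⟨i, rfl⟩
  · exact Or.inr (Or.inl ⟨i, j, rfl⟩)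
  · exact Or.inr (Or.inr ⟨i, rfl⟩)

theorem commute_euler_lieSymb {X : Fin n → SmoothFn n} (hX : X ∈ slFields n) :
    Commute (euler n) (lieSymb 0 X) := by
  have hw := weylRel_symb n
  rcases slFields_cases hX with ⟨i, rfl⟩ | ⟨i, j, rfl⟩ | ⟨i, rfl⟩
  · rw [lieSymb_const]
    exact hw.eulerMom_p i
  · rw [lieSymb_lin]
    exact hw.commute_eulerMom_lin mulBy_X_comm i j
  · rw [lieSymb_quad]
    exact hw.commute_eulerMom_quad mulBy_X_comm i

theorem euler_pdxi (i : Fin n) (P : Symb n) :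
    euler n (pdxi i P) = pdxi i (euler n P) - pdxi i P :=
  eq_sub_of_add_eq (LinearMap.congr_fun ((weylRel_symb n).swap_mom i) P).symm

theorem pdxi_eq_zero (i : Fin n) {P : Symb n} (hP : P.IsHomogeneous 0) : pdxi i P = 0 := by
  refine eq_zero_of_euler (c := -1) ?_ fun k hk => ?_
  · rw [euler_pdxi, euler_of_isHomogeneous hP]
    simp
  · have : ((k + 1 : ℕ) : ℂ) = 0 := by push_cast; rw [hk]; ring
    exact Nat.succ_ne_zero k (Nat.cast_injective (R := ℂ) (by simpa using this))

/-- One divergence costs -∂/∂ξᵢ(2𝓔 + n - 1), and ∂/∂ξᵢ commutes with the divergence. The coefficient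
is the sum of 2(k-j) + n - 1 over 0 ≤ j ≤ m. -/
theorem divg_pow_lieSymb_quad (i : Fin n) {k : ℕ} {P : Symb n} (hP : P.IsHomogeneous k) (m : ℕ) :
    (divg n ^ (m + 1)) (lieSymb 0 (fun j => coord i * coord j) P) =
      lieSymb 0 (fun j => coord i * coord j) ((divg n ^ (m + 1)) P)
        - (((m : ℂ) + 1) * (2 * k - m - 1 + n)) • pdxi i ((divg n ^ m) P) := by
  have hw := weylRel_symb n
  have hd : ∀ R : Symb n, divg n (lieSymb 0 (fun j => coord i * coord j) R) =
      lieSymb 0 (fun j => coord i * coord j) (divg n R)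
        - pdxi i ((2 : ℂ) • euler n R + (n : ℂ) • R - R) := by
    intro R
    have := LinearMap.congr_fun (hw.div_quad i) R
    rw [← lieSymb_quad, ← euler, ← divg] at this
    simp only [Module.End.mul_apply, LinearMap.sub_apply, LinearMap.add_apply, Fintype.card_fin,
      Module.End.natCast_apply, Module.End.one_apply, two_mul] at this
    rw [this, two_smul, Nat.cast_smul_eq_nsmul]
  have hq : ∀ R : Symb n, divg n (pdxi i R) = pdxi i (divg n R) :=
    fun R => LinearMap.congr_fun (hw.div_q i) R
  induction m with
  | zero =>
    rw [zero_add, pow_one, hd, euler_of_isHomogeneous hP, pow_zero, Module.End.one_apply,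
      ← map_smul]
    congr 2
    push_cast
    module
  | succ m ih =>
    rw [pow_succ', Module.End.mul_apply, ih, map_sub, hd, euler_divg_pow hP, map_smul, hq,
      ← Module.End.mul_apply (divg n), ← pow_succ', ← Module.End.mul_apply (divg n), ← pow_succ']
    simp only [map_sub, map_add, map_smul]
    push_cast
    module

/-! ### Existence of the quantization map -/

/-- The operator `F(2E; E | Z)` on symbols. -/
def confluentLin (n : ℕ) (hbar : ℝ) : Module.End ℂ (Symb n) :=
  hypLin [(2 : ℂ) • eulerShift n] [eulerShift n] (varZ n hbar) (exists_varZ_pow_eq_zero hbar)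

theorem confluentLin_apply (hbar : ℝ) (P : Symb n) : confluentLin n hbar P =
    hyp [(2 : ℂ) • eulerShift n] [eulerShift n] (varZ n hbar) P := rfl

theorem confluentLin_of_isHomogeneous (hn : 1 ≤ n) (hbar : ℝ) {k : ℕ} {P : Symb n}
    (hP : P.IsHomogeneous k) : confluentLin n hbar P = ∑ m ∈ Finset.range (k + 1),
      ((quantCoeff n (1 / 2) 0 k m : ℂ) * (Complex.I * hbar) ^ m) • (divg n ^ m) P := by
  rw [confluentLin_apply, hyp_confluent_of_isHomogeneous hn hbar hP]
  refine Finset.sum_congr rfl fun m _ => ?_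
  rw [smul_pow, LinearMap.smul_apply, smul_smul]

/-- In each degree the series is a polynomial in the divergence whose coefficients depend on the
degree alone. -/
theorem confluentLin_commute (hn : 1 ≤ n) (hbar : ℝ) {L : Module.End ℂ (Symb n)}
    (he : Commute (euler n) L) (hd : Commute (divg n) L) :
    confluentLin n hbar * L = L * confluentLin n hbar := by
  refine symb_linear_ext_homogeneous fun k P hP => ?_
  rw [Module.End.mul_apply, Module.End.mul_apply, confluentLin_of_isHomogeneous hn hbar hP,
    confluentLin_of_isHomogeneous hn hbar (isHomogeneous_of_commute he hP), map_sum]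
  refine Finset.sum_congr rfl fun m _ => ?_
  rw [map_smul, ← Module.End.mul_apply, (hd.pow_left m).eq, Module.End.mul_apply]

theorem quantCoeff_succ_mul (hn : 1 ≤ n) {k m : ℕ} (hm : m < k) :
    (quantCoeff n (1 / 2) 0 k (m + 1) : ℂ) * (((m : ℂ) + 1) * (2 * k - m - 1 + n)) =
      ((k : ℂ) - m + (n - 1) / 2) * quantCoeff n (1 / 2) 0 k m := by
  obtain ⟨l, rfl⟩ := Nat.exists_eq_add_of_lt hm
  rw [quantCoeff]
  push_cast
  have b2 : (2 * ((m : ℂ) + l + 1) - m - 1 + n) ≠ 0 := by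
    have : ((m + 2 * l + 1 + n : ℕ) : ℂ) ≠ 0 := by exact_mod_cast Nat.ne_of_gt (by omega)
    convert this using 1
    push_cast
    ring
  have b3 : ((m : ℂ) + 1) ≠ 0 := by exact_mod_cast Nat.succ_ne_zero m
  rw [show (2 * ((m : ℂ) + l + 1) - m - 2 + (n + 1) * (1 - 0)) = 2 * (m + l + 1) - m - 1 + n by
    ring, div_mul_eq_mul_div, div_mul_cancel₀ _ (mul_ne_zero b3 b2)]
  ring

theorem confluentLin_lieSymb_quad (hn : 1 ≤ n) (hbar : ℝ) (i : Fin n) {k : ℕ} {P : Symb n}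
    (hP : P.IsHomogeneous k) :
    confluentLin n hbar (lieSymb 0 (fun j => coord i * coord j) P) =
      lieSymb 0 (fun j => coord i * coord j) (confluentLin n hbar P) + (-Complex.I * hbar) •
        pdxi i (euler n (confluentLin n hbar P)
          + (((n : ℂ) - 1) / 2) • confluentLin n hbar P) := by
  have hX : (fun j => coord i * coord j) ∈ slFields n := Or.inr ⟨i, rfl⟩
  set T : ℕ → ℂ := fun m => (quantCoeff n (1 / 2) 0 k m : ℂ) * (Complex.I * hbar) ^ m with hT
  -- The term m = 0 is the identity and passes through; the others, reindexed by m + 1, each leave a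
  -- commutator.
  have hl : confluentLin n hbar (lieSymb 0 (fun j => coord i * coord j) P) =
      lieSymb 0 (fun j => coord i * coord j) (confluentLin n hbar P) -
        ∑ m ∈ Finset.range k, (T (m + 1) * (((m : ℂ) + 1) * (2 * k - m - 1 + n))) •
          pdxi i ((divg n ^ m) P) := by
    rw [confluentLin_of_isHomogeneous hn hbar hP, confluentLin_of_isHomogeneous hn hbar
      (isHomogeneous_of_commute (commute_euler_lieSymb hX) hP), Finset.sum_range_succ',
      Finset.sum_range_succ', map_add, map_sum, add_sub_right_comm, ← Finset.sum_sub_distrib]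
    congr 1
    · refine Finset.sum_congr rfl fun m _ => ?_
      rw [divg_pow_lieSymb_quad i hP, smul_sub, map_smul, smul_smul]
    · rw [map_smul]
      rfl
  have hr : (-Complex.I * hbar) • pdxi i (euler n (confluentLin n hbar P)
      + (((n : ℂ) - 1) / 2) • confluentLin n hbar P) =
      ∑ m ∈ Finset.range k, ((-Complex.I * hbar) * (T m * ((k : ℂ) - m + (n - 1) / 2))) •
        pdxi i ((divg n ^ m) P) := by
    rw [confluentLin_of_isHomogeneous hn hbar hP, map_sum, Finset.smul_sum,
      ← Finset.sum_add_distrib, map_sum, Finset.smul_sum, Finset.sum_range_succ]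
    -- The top term has degree zero in ξ, so its ξ-derivative vanishes and both sums run over m < k.
    have h0 : pdxi i ((divg n ^ k) P) = 0 :=
      pdxi_eq_zero i (divg_pow_isHomogeneous (by rwa [zero_add]))
    have hs : ∀ m, (-Complex.I * hbar) • pdxi i (euler n (T m • (divg n ^ m) P)
        + (((n : ℂ) - 1) / 2) • T m • (divg n ^ m) P) =
        ((-Complex.I * hbar) * (T m * ((k : ℂ) - m + (n - 1) / 2))) •
          pdxi i ((divg n ^ m) P) := by
      intro m
      rw [map_smul, euler_divg_pow hP]
      simp only [map_add, map_smul]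
      module
    rw [Finset.sum_congr rfl fun m _ => hs m, hs k, h0, smul_zero, add_zero]
  rw [hl, hr, sub_eq_add_neg, ← Finset.sum_neg_distrib]
  congr 1
  refine Finset.sum_congr rfl fun m hm => ?_
  rw [← neg_smul]
  congr 1
  have := quantCoeff_succ_mul hn (Finset.mem_range.1 hm)
  simp only [hT, pow_succ]
  linear_combination (-(Complex.I * hbar) ^ m * (Complex.I * hbar)) * this

theorem lieOp_fourierLin_confluentLin (hn : 1 ≤ n) {hbar : ℝ} (h : hbar ≠ 0)
    {X : Fin n → SmoothFn n} (hX : X ∈ slFields n) (P : Symb n) :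
    lieOp (1 / 2) (1 / 2) X (fourierLin n hbar (confluentLin n hbar P)) =
      fourierLin n hbar (confluentLin n hbar (lieSymb 0 X P)) := by
  have hw := weylRel_symb n
  have he := commute_euler_lieSymb hX
  rcases slFields_cases hX with ⟨i, rfl⟩ | ⟨i, j, rfl⟩ | ⟨i, rfl⟩
  · have hd : Commute (divg n) (lieSymb 0 (Pi.single i (1 : SmoothFn n))) := by
      rw [lieSymb_const]
      exact hw.div_p i
    rw [lieOp_const_fourierLin, ← Module.End.mul_apply, ← Module.End.mul_apply,
      confluentLin_commute hn hbar he hd]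
  · have hd : Commute (divg n) (lieSymb 0 (Pi.single j (coord i : SmoothFn n))) := by
      rw [lieSymb_lin]
      exact hw.commute_div_lin i j
    rw [lieOp_lin_fourierLin h, ← Module.End.mul_apply, ← Module.End.mul_apply,
      confluentLin_commute hn hbar he hd]
  · rw [lieOp_quad_fourierLin h]
    have key : confluentLin n hbar * lieSymb 0 (fun j => coord i * coord j) =
        lieSymb 0 (fun j => coord i * coord j) * confluentLin n hbar +
          (-Complex.I * hbar) • (pdxi i * (euler n + (((n : ℂ) - 1) / 2) • 1)
            * confluentLin n hbar) :=
      symb_linear_ext_homogeneous fun k P hP => confluentLin_lieSymb_quad hn hbar i hP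
    exact congrArg (fourierLin n hbar) (LinearMap.congr_fun key P).symm

/-- The quantization map for half-densities. -/
def quantMap (n : ℕ) (hbar : ℝ) : Symb n →ₗ[ℂ] DiffOp n :=
  (fourierLin n hbar ∘ₗ confluentLin n hbar).codRestrict (DiffOp n) fun _ =>
    fourierLin_mem_diffOp hbar _

theorem coe_quantMap (hbar : ℝ) (P : Symb n) :
    (quantMap n hbar P : Op n) = fourierLin n hbar (confluentLin n hbar P) := rfl

theorem confluentLin_sub_mem (hn : 1 ≤ n) (hbar : ℝ) {k : ℕ} {P : Symb n}
    (hP : P.IsHomogeneous k) : confluentLin n hbar P - P ∈ lowSymb n k := by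
  rw [confluentLin_of_isHomogeneous hn hbar hP, Finset.sum_range_succ']
  simp only [quantCoeff, Complex.ofReal_one, pow_zero, mul_one, one_smul, Module.End.one_apply,
    add_sub_cancel_right]
  refine sum_mem fun m hm => Submodule.smul_mem _ _ ?_
  have hmk := Finset.mem_range.1 hm
  exact isHomogeneous_mem_lowSymb (j := k - (m + 1))
    (divg_pow_isHomogeneous (by rwa [Nat.sub_add_cancel hmk])) (by omega)

theorem isProjQuantization_quantMap (hn : 1 ≤ n) {hbar : ℝ} (h : hbar ≠ 0) :
    IsProjQuantization (1 / 2) (1 / 2) hbar (quantMap n hbar) where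
  equivariant X hX P := by
    rw [sub_self, coe_quantMap, coe_quantMap, lieOp_fourierLin_confluentLin hn h hX]
  normalized k P hP := by
    -- Two corrections of order less than k: the terms m ≥ 1 of the series, and the reordering of
    -- derivatives and coefficients.
    obtain ⟨R, hR, hRe⟩ := add_mem (fourierLin_mem hbar (confluentLin_sub_mem hn hbar hP))
      (fourierLin_sub_mem hbar hP)
    refine ⟨R, mem_lowSymb.1 hR, ?_⟩
    rw [← coeffLin_apply, ← coeffLin_apply, hRe, coe_quantMap, map_sub]
    abel

/-! ### Uniqueness of the quantization map -/

/-- The Casimir operator of the projective action on symbols, transported to differential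
operators by `fourierLin`. -/
def casimirLow (n : ℕ) (hbar : ℝ) : Module.End ℂ (Symb n) :=
  (2 : ℂ) • (euler n * (euler n + (n : ℂ) • 1))
    - (2 * (-Complex.I * hbar)) • (divg n * (euler n + (((n : ℂ) - 1) / 2) • 1))

/-- This is the Casimir expression with the quadratic fields acting as they do on operators. Their
corrections, composed with ∂/∂xⁱ and summed, give the divergence of 𝓔 + (n-1)/2, the triangular
part. -/
theorem casimirLow_eq (hbar : ℝ) (R : Symb n) : casimirLow n hbar R =
    (∑ i, ∑ j, lieSymb 0 (Pi.single j (coord i)) (lieSymb 0 (Pi.single i (coord j)) R))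
      - (2 : ℂ) • (∑ i, (lieSymb 0 (fun j => coord i * coord j)
          (lieSymb 0 (Pi.single i 1) R) + (-Complex.I * hbar) • pdxi i
            (euler n (lieSymb 0 (Pi.single i 1) R)
              + (((n : ℂ) - 1) / 2) • lieSymb 0 (Pi.single i 1) R)))
      + (∑ i, lieSymb 0 (Pi.single i (coord i)) (∑ j, lieSymb 0 (Pi.single j (coord j)) R))
      - ((n : ℂ) + 1) • (∑ i, lieSymb 0 (Pi.single i (coord i)) R) := by
  have hw := weylRel_symb n
  have hc := LinearMap.congr_fun hw.casimir R
  have hp : ∀ i : Fin n, euler n (pdx i R) = pdx i (euler n R) := fun i =>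
    LinearMap.congr_fun (hw.eulerMom_p i) R
  have hD : ∀ S : Symb n, divg n S = ∑ i, pdxi i (pdx i S) := fun S => by
    rw [divg, LinearMap.sum_apply]
    exact Finset.sum_congr rfl fun i _ => pdx_pdxi_comm i i S
  have hs : ∑ i, pdxi i (euler n (pdx i R) + (((n : ℂ) - 1) / 2) • pdx i R) =
      divg n (euler n R + (((n : ℂ) - 1) / 2) • R) := by
    rw [hD]
    refine Finset.sum_congr rfl fun i _ => ?_
    rw [hp, ← map_smul, ← map_add]
  have g1 : ∑ i : Fin n, ∑ j,
      lieSymb 0 (Pi.single j (coord i)) (lieSymb 0 (Pi.single i (coord j)) R) =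
      (∑ i : Fin n, ∑ j, (mulBy (C (coord i)) * pdx j - mulBy (X j) * pdxi i) *
        (mulBy (C (coord j)) * pdx i - mulBy (X i) * pdxi j) : Module.End ℂ (Symb n)) R := by
    rw [LinearMap.sum_apply]
    refine Finset.sum_congr rfl fun i _ => ?_
    rw [LinearMap.sum_apply]
    refine Finset.sum_congr rfl fun j _ => ?_
    rw [lieSymb_lin, lieSymb_lin, Module.End.mul_apply]
  have g2 : ∑ i : Fin n, lieSymb 0 (fun j => coord i * coord j)
      (lieSymb 0 (Pi.single i (1 : SmoothFn n)) R) = (∑ i, WeylRel.quad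
        (fun i : Fin n => mulBy (C (coord i))) (fun i => mulBy (X i)) pdx pdxi i * pdx i) R := by
    rw [LinearMap.sum_apply]
    refine Finset.sum_congr rfl fun i _ => ?_
    rw [lieSymb_const, lieSymb_quad, Module.End.mul_apply]
  have g4 : ∀ S : Symb n, ∑ i : Fin n, lieSymb 0 (Pi.single i (coord i)) S =
      (∑ i : Fin n, (mulBy (C (coord i)) * pdx i - mulBy (X i) * pdxi i) :
        Module.End ℂ (Symb n)) S := by
    intro S
    rw [LinearMap.sum_apply]
    exact Finset.sum_congr rfl fun i _ => by rw [lieSymb_lin]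
  rw [Finset.sum_add_distrib, ← Finset.smul_sum, g1, g2, g4, g4]
  simp only [lieSymb_const]
  rw [hs]
  rw [← euler] at hc
  generalize (∑ i : Fin n, ∑ j, (mulBy (C (coord i)) * pdx j - mulBy (X j) * pdxi i) *
        (mulBy (C (coord j)) * pdx i - mulBy (X i) * pdxi j) : Module.End ℂ (Symb n)) = A1 at *
  generalize (∑ i, WeylRel.quad (fun i : Fin n => mulBy (C (coord i))) (fun i => mulBy (X i))
    pdx pdxi i * pdx i) = A2 at *
  generalize (∑ i : Fin n, (mulBy (C (coord i)) * pdx i - mulBy (X i) * pdxi i) :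
    Module.End ℂ (Symb n)) = A3 at *
  simp only [LinearMap.sub_apply, LinearMap.add_apply, Module.End.mul_apply,
    Fintype.card_fin, two_mul, add_mul, one_mul, Module.End.natCast_apply,
    ← Nat.cast_smul_eq_nsmul ℂ, map_add, map_smul] at hc
  simp only [casimirLow, LinearMap.sub_apply, LinearMap.add_apply, LinearMap.smul_apply,
    Module.End.mul_apply, Module.End.one_apply, map_add, map_smul]
  have hc' : (2 : ℂ) • (euler n (euler n R) + (n : ℂ) • euler n R) =
      A1 R - (2 : ℂ) • A2 R + A3 (A3 R) - ((n : ℂ) + 1) • A3 R := by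
    rw [two_smul, two_smul, add_smul, one_smul]
    exact hc.symm
  rw [hc']
  module

theorem casimir_of_isHomogeneous {k : ℕ} {P : Symb n} (hP : P.IsHomogeneous k) :
    (2 : ℂ) • euler n (euler n P + (n : ℂ) • P) = ((2 : ℂ) * (k * (k + n))) • P := by
  rw [euler_of_isHomogeneous hP, map_add, map_smul, map_smul, euler_of_isHomogeneous hP]
  module

theorem casimir_symb (P : Symb n) :
    (2 : ℂ) • euler n (euler n P + (n : ℂ) • P) =
    (∑ i : Fin n, ∑ j,
        lieSymb 0 (Pi.single j (coord i)) (lieSymb 0 (Pi.single i (coord j)) P))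
      - (2 : ℂ) • (∑ i : Fin n, lieSymb 0 (fun j => coord i * coord j)
          (lieSymb 0 (Pi.single i 1) P))
      + (∑ i : Fin n, lieSymb 0 (Pi.single i (coord i))
          (∑ j : Fin n, lieSymb 0 (Pi.single j (coord j)) P))
      - ((n : ℂ) + 1) • (∑ i : Fin n, lieSymb 0 (Pi.single i (coord i)) P) := by
  -- At ħ = 0 the corrections disappear and the Casimir on symbols remains.
  have := casimirLow_eq 0 P
  simpa [casimirLow] using this

/-- An eigenvector of the Casimir operator with the eigenvalue of degree `k` and of degree less
than `k` vanishes. -/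
theorem eq_zero_of_casimirLow (hbar : ℝ) {k : ℕ} {R : Symb n} (hR : R ∈ lowSymb n k)
    (h : casimirLow n hbar R = ((2 : ℂ) * (k * (k + n))) • R) : R = 0 := by
  have key : ∀ l, l ≤ k → R ∈ lowSymb n l → R = 0 := by
    intro l
    induction l with
    | zero => exact fun _ hR => MvPolynomial.ext _ _ fun β => hR β (Nat.zero_le _)
    | succ d ih =>
      intro hd hR
      refine ih (by omega) fun β hβ => ?_
      by_cases hβd : d + 1 ≤ β.degree
      · exact hR β hβd
      have hβ' : β.degree = d := by omega
      have hc : ∀ c : ℂ, euler n + c • 1 = degMul n fun k => (k : ℂ) + c := by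
        intro c
        rw [euler_eq_degMul, ← map_one (degMul n), ← map_smul, ← map_add]
        congr 1
        funext k
        simp
      -- The divergence lowers the degree, so it contributes nothing to the top component, of degree
      -- d.
      have h1 : (divg n ((euler n + (((n : ℂ) - 1) / 2) • 1) R)).coeff β = 0 := by
        refine divg_mem_lowSymb (fun γ hγ => ?_) β hβ
        rw [hc, coeff_degMul, hR γ hγ, smul_zero]
      have h2 := congrArg (coeff β) h
      rw [casimirLow, LinearMap.sub_apply, LinearMap.smul_apply, LinearMap.smul_apply,
        Module.End.mul_apply (divg n), coeff_sub, coeff_smul, coeff_smul, coeff_smul, h1, smul_zero,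
        sub_zero, hc, euler_eq_degMul, ← map_mul, coeff_degMul, smul_smul, ← sub_eq_zero,
        ← sub_smul, hβ', Pi.mul_apply] at h2
      refine (smul_eq_zero.1 h2).resolve_left fun h3 => ?_
      have h4 : ((d * (d + n) : ℕ) : ℂ) = ((k * (k + n) : ℕ) : ℂ) := by
        push_cast
        linear_combination h3 / 2
      have h5 : d * (d + n) = k * (k + n) := Nat.cast_injective h4
      -- d < k forces d(d+n) < k(k+n).
      nlinarith
  exact key k le_rfl hR

/-- An equivariant map from symbols to operators that lowers the order vanishes. -/
theorem eq_zero_of_equivariant {hbar : ℝ} (h : hbar ≠ 0) (N : Symb n →ₗ[ℂ] Op n)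
    (hN : ∀ X ∈ slFields n, ∀ P, N (lieSymb 0 X P) = lieOp (1 / 2) (1 / 2) X (N P))
    (hlow : ∀ k P, P.IsHomogeneous k → N P ∈ (lowSymb n k).map (coeffLin n)) : N = 0 := by
  -- If R represents the operator N P, the Lie derivatives of P are sent to the corrected Lie
  -- derivatives of R, so any word in them, in particular the Casimir, can be carried across N.
  have hconst : ∀ (i : Fin n) {P R : Symb n}, N P = fourierLin n hbar R →
      N (lieSymb 0 (Pi.single i 1) P) = fourierLin n hbar (lieSymb 0 (Pi.single i 1) R) :=
    fun i P R hPR => by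
      rw [hN _ (Or.inl (Or.inl ⟨i, rfl⟩)), hPR, lieOp_const_fourierLin]
  have hlin : ∀ (i j : Fin n) {P R : Symb n}, N P = fourierLin n hbar R →
      N (lieSymb 0 (Pi.single j (coord i)) P) =
        fourierLin n hbar (lieSymb 0 (Pi.single j (coord i)) R) :=
    fun i j P R hPR => by
      rw [hN _ (Or.inl (Or.inr ⟨(i, j), rfl⟩)), hPR, lieOp_lin_fourierLin h]
  have hquad : ∀ (i : Fin n) {P R : Symb n}, N P = fourierLin n hbar R →
      N (lieSymb 0 (fun j => coord i * coord j) P) =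
        fourierLin n hbar (lieSymb 0 (fun j => coord i * coord j) R + (-Complex.I * hbar) •
          pdxi i (euler n R + (((n : ℂ) - 1) / 2) • R)) :=
    fun i P R hPR => by
      rw [hN _ (Or.inr ⟨i, rfl⟩), hPR, lieOp_quad_fourierLin h]
  have hsum : ∀ {P R : Fin n → Symb n}, (∀ i, N (P i) = fourierLin n hbar (R i)) →
      N (∑ i, P i) = fourierLin n hbar (∑ i, R i) := fun hPR => by
    rw [map_sum, map_sum]
    exact Finset.sum_congr rfl fun i _ => hPR i
  refine symb_linear_ext_homogeneous fun k P hP => ?_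
  obtain ⟨R, hR, hRP⟩ := map_coeffLin_le h k (hlow k P hP)
  have hcas : N ((2 : ℂ) • euler n (euler n P + (n : ℂ) • P)) =
      fourierLin n hbar (casimirLow n hbar R) := by
    rw [casimir_symb, casimirLow_eq, map_sub, map_add, map_sub, map_smul, map_smul,
      hsum fun i => hsum fun j => hlin i j (hlin j i hRP.symm),
      hsum fun i => hquad i (hconst i hRP.symm),
      hsum fun i => hlin i i (hsum fun j => hlin j j hRP.symm),
      hsum fun i => hlin i i hRP.symm]
    simp only [map_sub, map_add, map_smul]
  rw [casimir_of_isHomogeneous hP, map_smul, ← hRP, ← map_smul] at hcas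
  rw [← hRP, eq_zero_of_casimirLow hbar hR (fourierLin_injective h hcas).symm, map_zero]
  rfl

theorem IsProjQuantization.unique {hbar : ℝ} (h : hbar ≠ 0) {Q Q' : Symb n →ₗ[ℂ] DiffOp n}
    (hQ : IsProjQuantization (1 / 2) (1 / 2) hbar Q)
    (hQ' : IsProjQuantization (1 / 2) (1 / 2) hbar Q') : Q' = Q := by
  have hN := eq_zero_of_equivariant h ((DiffOp n).subtype ∘ₗ Q' - (DiffOp n).subtype ∘ₗ Q)
    (fun X hX P => ?_) fun k P hP => ?_
  · refine LinearMap.ext fun P => Subtype.ext ?_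
    exact sub_eq_zero.1 (LinearMap.congr_fun hN P)
  · have h1 := hQ.equivariant X hX P
    have h2 := hQ'.equivariant X hX P
    rw [sub_self] at h1 h2
    change (Q' (lieSymb 0 X P) : Op n) - (Q (lieSymb 0 X P) : Op n) =
      lieOp (1 / 2) (1 / 2) X ((Q' P : Op n) - (Q P : Op n))
    rw [h1, h2, lieOp, lieOp, lieOp, mul_sub, sub_mul]
    abel
  · obtain ⟨R, hR, hQR⟩ := hQ.normalized k P hP
    obtain ⟨R', hR', hQR'⟩ := hQ'.normalized k P hP
    -- The principal terms prescribed by the normalization are equal and cancel.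
    refine ⟨R' - R, sub_mem (mem_lowSymb.2 hR') (mem_lowSymb.2 hR), ?_⟩
    change coeffLin n (R' - R) = (Q' P : Op n) - (Q P : Op n)
    rw [hQR, hQR', map_sub, coeffLin_apply, coeffLin_apply, add_sub_add_left_eq_sub]

end

end ProjQuant

end

/-! ### The quantization map for half-densities -/

open ProjQuant in
theorem corollary3p4 (n : ℕ) (hn : 1 ≤ n) (hbar : ℝ) (hhbar : hbar ≠ 0) :
    -- the series are meaningful on every symbol
    (∀ m : ℕ, IsUnit (poch (eulerShift n) m)) ∧
    (∀ m : ℕ, ∀ b ∈ paramsB n (1 / 2) (1 / 2), IsUnit (poch b m)) ∧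
    (∀ P : Symb n, ∃ N : ℕ, ∀ m : ℕ, N ≤ m → (varZ n hbar ^ m) P = 0) ∧
    -- the quantization map for half-densities exists, is unique, and is given by the formulas
    ∃ Q : Symb n →ₗ[ℂ] DiffOp n,
      IsProjQuantization (1 / 2) (1 / 2) hbar Q ∧
      (∀ Q' : Symb n →ₗ[ℂ] DiffOp n, IsProjQuantization (1 / 2) (1 / 2) hbar Q' → Q' = Q) ∧
      -- the recursive description in each degree
      (∀ (k : ℕ) (P : Symb n), P.IsHomogeneous k →
        (Q P : Op n) = fourierOp hbar (∑ m ∈ Finset.range (k + 1),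
          (quantCoeff n (1 / 2) 0 k m : ℂ) • (((Complex.I * hbar) • divg n) ^ m) P)) ∧
      -- the hypergeometric series with four parameters
      (∀ P : Symb n, (Q P : Op n) =
        fourierOp hbar (hyp (paramsA n (1 / 2) (1 / 2)) (paramsB n (1 / 2) (1 / 2))
          (varZ n hbar) P)) ∧
      -- its reduction to the confluent hypergeometric series
      (∀ P : Symb n, hyp (paramsA n (1 / 2) (1 / 2)) (paramsB n (1 / 2) (1 / 2)) (varZ n hbar) P =
        hyp [(2 : ℂ) • eulerShift n] [eulerShift n] (varZ n hbar) P) ∧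
      (∀ P : Symb n, (Q P : Op n) =
        fourierOp hbar (hyp [(2 : ℂ) • eulerShift n] [eulerShift n] (varZ n hbar) P)) := by
  have hQ := isProjQuantization_quantMap hn hhbar
  refine ⟨isUnit_poch_eulerShift hn, isUnit_poch_paramsB hn, exists_varZ_pow_eq_zero hbar,
    quantMap n hbar, hQ, fun Q' hQ' => hQ.unique hhbar hQ', fun k P hP => ?_, fun P => ?_,
    hyp_params_half hn (varZ n hbar), fun P => ?_⟩
  · rw [← hyp_confluent_of_isHomogeneous hn hbar hP]
    rfl
  · rw [hyp_params_half hn]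
    rfl
  · rfl
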